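/- Fix $q\in(0,1)$. Let $SU_q(2)$ be the universal unital $C^*$-algebra generated by $a,b$ subject to $ba=qab$, $b^*a=qab^*$, $bb^*=b^*b$, $a^*a+q^2bb^*=1=aa^*+bb^*$, let $h$ be its Haar state, and let $H_h$ be the completion of $SU_q(2)$ for $\langle x,y\rangle=h(x^*y)$, on which $SU_q(2)$ acts by left multiplication. Let $\partial_k$ be the automorphism of the unital $*$-subalgebra $\mathcal O(SU_q(2))$ generated by $a,b$ with $\partial_k(a)=q^{1/2}a$, $\partial_k(b)=q^{1/2}b$, $\partial_k(a^*)=q^{-1/2}a^*$, $\partial_k(b^*)=q^{-1/2}b^*$, and let $H_\pm\subseteq H_h$ be the closure of $\{x\in\mathcal O(SU_q(2)) : \partial_k(x)=q^{\pm1/2}x\}$. Let $S_q^2\subseteq SU_q(2)$ be the unital $C^*$-subalgebra generated by $A:=b^*b$ and $B:=ab^*$; it acts on $H_+$ and on $H_-$. The spectrum of $A$ is $\{0\}\cup\{q^{2k}:k\ge 0\}$. Write $\chi_k:=\chi_{\{q^{2k}\}}(A)$ and $Y_k:=S_q^2\,\chi_k$. For $n,k\ge 0$ put $C_{n,k}:=\prod_{j=\min(n,k)}^{\max(n,k)-1}q^{2j}(1-q^{2(j+1)})$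 and $f_{n,k}:=C_{n,k}^{-1/2}B^{n-k}\chi_k$ for $n\ge k$, $f_{n,k}:=C_{n,k}^{-1/2}(B^*)^{k-n}\chi_k$ for $n<k$; then $Y_k$ is a Hilbert space (with the norm of $S_q^2$) with orthonormal basis $(f_{n,k})_{n\ge0}$. Define bounded operators $S^V:Y_k\to Y_k$, $S^Vf_{n,k}=f_{n+1,k}$; $S^H:Y_k\to Y_{k+1}$, $S^Hf_{n,k}=f_{n+1,k+1}$, with adjoint $(S^H)^*:Y_{k+1}\to Y_k$; $\Gamma:Y_k\to Y_k$, $\Gamma f_{n,k}=q^{n-k-1}\big(\tfrac{1-q^{2(k+1)}}{1-q^{2n}}\big)^{1/2}f_{n,k}$ for $n\ge k+1$ and $\Gamma f_{n,k}=0$ for $n\le k$; for $k\ge1$, $\Delta:Y_k\to Y_k$, $\Delta f_{n,k}=q^{k-n+1}\big(\tfrac{1-q^{2(n-1)}}{1-q^{2k}}\big)^{1/2}f_{n,k}$ for $0<n\le k$ and $\Delta f_{n,k}=0$ otherwise; and $P:Y_k\to Y_k$ the orthogonal projection onto the span of $f_{0,k},\dots,f_{k,k}$. Let $X$ be the space of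 all bounded operators $\xi:H_+\to H_-$ such that $\xi\,\chi_k\in Y_k\,(b^*)^2$ for all $k\ge0$ (elements of $Y_k(b^*)^2$ acting as left multiplication operators $H_+\to H_-$). For $\xi\in X$ put $\xi_l:=\xi\,\chi_l\,b^2q^{-2l}\in Y_l$ and define the quantum integral $\int\xi:=\int^V\xi+\int^H\xi\in S_q^2$, where $$\int^V\xi:=-\sum_{m=0}^\infty q^m\frac{1-q^2}{(1-q^{2(m+1)})^{1/2}}\sum_{l=0}^m\Gamma(S^H\Gamma)^{m-l}S^V\xi_l,$$ $$\int^H\xi:=\sum_{m=0}^\infty q^m\frac{1-q^2}{(1-q^{2(m+1)})^{1/2}}\sum_{l=m+1}^\infty(S^H)^*\big((S^H)^*\Delta\big)^{l-m-1}PS^V\xi_l .$$ Then for every $\xi\in X$ these series converge in norm (unconditionally), and for all $k\ge0$ $$\Big\|\Big(\int\xi\Big)\chi_{[0,q^{2k}]}(A)\Big\|\le\|\xi\|_\infty\,q^k\,(k+2)\,(1-q)^{-2},$$ where $\|\xi\|_\infty$ is the operator norm of $\xi$. -/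

import Mathlib

/-!
The quantum group `SU_q(2)`, the standard Podles sphere, its matrix units and fibres,
and the quantum integral, for a deformation parameter `q` in the open interval `(0, 1)`.
-/

namespace Podles

open scoped ComplexOrder ENNReal InnerProductSpace

noncomputable section

/-! ### The universal C*-algebra `SU_q(2)` -/

/-- The defining relations of `SU_q(2)` for a pair of elements of a `*`-algebra. -/
structure IsSUqPair {R : Type*} [Ring R] [StarRing R] [Algebra ℂ R] (q : ℝ) (a b : R) : Prop where
  rel_ba : b * a = (q : ℂ) • (a * b)
  rel_bstar_a : star b * a = (q : ℂ) • (a * star b)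
  normal_b : b * star b = star b * b
  left_unitary : star a * a + ((q : ℂ) ^ 2) • (b * star b) = 1
  right_unitary : a * star a + b * star b = 1

/-- A separable infinite dimensional Hilbert space. -/
abbrev K : Type := lp (fun _ : ℕ × ℤ => ℂ) 2

instance : Nontrivial K :=
  ⟨⟨lp.single 2 ((0 : ℕ), (0 : ℤ)) (1 : ℂ), 0, fun h => by
    have h2 := congrArg (fun v : K => v ((0 : ℕ), (0 : ℤ))) h
    simp at h2⟩⟩

/-- All representations of the defining relations by bounded operators on `K`. -/
def Reps (q : ℝ) : Type :=
  {p : (K →L[ℂ] K) × (K →L[ℂ] K) // IsSUqPair q p.1 p.2}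

/-- The `ℓ^∞`-product of copies of `B(K)`, one for each representation of the relations. -/
abbrev RepProd (q : ℝ) : Type := lp (fun _ : Reps q => K →L[ℂ] K) ∞

instance (q : ℝ) : CStarAlgebra (RepProd q) where

lemma norm_le_one_of_add_star {u v : K →L[ℂ] K} (h : u * star u + v * star v = 1) : ‖u‖ ≤ 1 := by
  have h1 : u * star u ≤ 1 := by
    rw [← h]
    exact le_add_of_nonneg_right (mul_star_self_nonneg v)
  have h2 : ‖u * star u‖ ≤ ‖(1 : K →L[ℂ] K)‖ :=
    CStarAlgebra.norm_le_norm_of_nonneg_of_le (mul_star_self_nonneg u) h1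
  have h3 : ‖u * star u‖ = ‖u‖ * ‖u‖ := CStarRing.norm_self_mul_star
  rw [h3, norm_one] at h2
  nlinarith [norm_nonneg u]

/-- The direct sum over all representations of the first generator. -/
def prodA (q : ℝ) : RepProd q :=
  ⟨fun i => i.1.1, memℓp_infty ⟨1, by
    rintro _ ⟨i, rfl⟩
    exact norm_le_one_of_add_star i.2.right_unitary⟩⟩

/-- The direct sum over all representations of the second generator. -/
def prodB (q : ℝ) : RepProd q :=
  ⟨fun i => i.1.2, memℓp_infty ⟨1, by
    rintro _ ⟨i, rfl⟩
    exact norm_le_one_of_add_star ((add_comm _ _).trans i.2.right_unitary)⟩⟩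

/-- The C*-algebra generated by the direct sum of all representations of the relations. Any
C*-algebra generated by two elements is separable and hence embeds in `B(K)`, so that this is
the universal unital C*-algebra on two generators subject to the relations. -/
def SUAlg (q : ℝ) : StarSubalgebra ℂ (RepProd q) :=
  (StarAlgebra.adjoin ℂ {prodA q, prodB q}).topologicalClosure

instance (q : ℝ) : IsClosed (SUAlg q : Set (RepProd q)) :=
  StarSubalgebra.isClosed_topologicalClosure _

/-- The C*-algebra `SU_q(2)`. -/
def SU (q : ℝ) : Type := SUAlg q

instance (q : ℝ) : CStarAlgebra (SU q) := inferInstanceAs (CStarAlgebra (SUAlg q))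

instance (q : ℝ) : PartialOrder (SU q) := CStarAlgebra.spectralOrder (SU q)

instance (q : ℝ) : StarOrderedRing (SU q) := CStarAlgebra.spectralOrderedRing (SU q)

/-- The generator `a`. -/
def gena (q : ℝ) : SU q :=
  ⟨prodA q, StarSubalgebra.le_topologicalClosure _ (StarAlgebra.subset_adjoin ℂ _ (by simp))⟩

/-- The generator `b`. -/
def genb (q : ℝ) : SU q :=
  ⟨prodB q, StarSubalgebra.le_topologicalClosure _ (StarAlgebra.subset_adjoin ℂ _ (by simp))⟩

/-- The representation of `SU_q(2)` determined by a representation of the relations. -/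
def evalRep {q : ℝ} (i : Reps q) : SU q →⋆ₐ[ℂ] (K →L[ℂ] K) where
  toFun x := (x.1 : RepProd q) i
  map_one' := rfl
  map_mul' _ _ := rfl
  map_zero' := rfl
  map_add' _ _ := rfl
  commutes' _ := rfl
  map_star' _ := rfl

lemma evalRep_gena {q : ℝ} (i : Reps q) : evalRep i (gena q) = i.1.1 := rfl

lemma evalRep_genb {q : ℝ} (i : Reps q) : evalRep i (genb q) = i.1.2 := rfl

lemma SU_ext {q : ℝ} {x y : SU q} (h : ∀ i : Reps q, evalRep i x = evalRep i y) : x = y :=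
  Subtype.ext (lp.ext (funext h))

lemma isSUqPair_gen (q : ℝ) : IsSUqPair q (gena q) (genb q) where
  rel_ba := SU_ext fun i => i.2.rel_ba
  rel_bstar_a := SU_ext fun i => i.2.rel_bstar_a
  normal_b := SU_ext fun i => i.2.normal_b
  left_unitary := SU_ext fun i => i.2.left_unitary
  right_unitary := SU_ext fun i => i.2.right_unitary

lemma norm_evalRep_le {q : ℝ} (i : Reps q) (x : SU q) : ‖evalRep i x‖ ≤ ‖x‖ :=
  lp.norm_apply_le_norm ENNReal.top_ne_zero (x.1 : RepProd q) i

/-! ### The Haar state -/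

lemma weightedComp_summable {w : ℕ × ℤ → ℝ} {σ : ℕ × ℤ → ℕ × ℤ} (hw : ∀ i, |w i| ≤ 1)
    (hσ : Set.InjOn σ {i | w i ≠ 0}) (v : K) :
    (Summable fun i => ‖(w i : ℂ) * v (σ i)‖ ^ (2 : ℝ)) ∧
      ∑' i, ‖(w i : ℂ) * v (σ i)‖ ^ (2 : ℝ) ≤ ‖v‖ ^ (2 : ℝ) := by
  have hv : HasSum (fun i => ‖v i‖ ^ (2 : ℝ)) (‖v‖ ^ (2 : ℝ)) := by
    simpa using lp.hasSum_norm (p := 2) (by norm_num) v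
  have hinj : Function.Injective fun s : {i | w i ≠ 0} => σ s.1 :=
    fun s t h => Subtype.ext (hσ s.2 t.2 h)
  have h1 : Summable fun s : {i | w i ≠ 0} => ‖v (σ s.1)‖ ^ (2 : ℝ) :=
    hv.summable.comp_injective hinj
  have hle : ∀ i, ‖(w i : ℂ) * v (σ i)‖ ^ (2 : ℝ) ≤ ‖v (σ i)‖ ^ (2 : ℝ) := fun i => by
    refine Real.rpow_le_rpow (norm_nonneg _) ?_ (by norm_num)
    rw [norm_mul, Complex.norm_real, Real.norm_eq_abs]
    exact mul_le_of_le_one_left (norm_nonneg _) (hw i)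
  have h2 : Summable fun s : {i | w i ≠ 0} => ‖(w s.1 : ℂ) * v (σ s.1)‖ ^ (2 : ℝ) :=
    h1.of_nonneg_of_le (fun _ => by positivity) fun s => hle s.1
  have hsupp : Function.support (fun i => ‖(w i : ℂ) * v (σ i)‖ ^ (2 : ℝ)) ⊆ {i | w i ≠ 0} := by
    intro i hi h0
    apply hi
    simp [h0]
  constructor
  · have h3 := (summable_subtype_iff_indicator (s := {i | w i ≠ 0})
      (f := fun i => ‖(w i : ℂ) * v (σ i)‖ ^ (2 : ℝ))).mp h2
    rwa [Set.indicator_eq_self.mpr hsupp] at h3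
  · rw [← tsum_subtype_eq_of_support_subset hsupp, ← hv.tsum_eq]
    refine le_trans (b := ∑' s : {i | w i ≠ 0}, ‖v (σ s.1)‖ ^ (2 : ℝ)) ?_ ?_
    · exact Summable.tsum_le_tsum (fun s => hle s.1) h2 h1
    · have h4 : ∀ i, 0 ≤ ‖v i‖ ^ (2 : ℝ) := fun i => by positivity
      exact tsum_comp_le_tsum_of_inj (f := fun i => ‖v i‖ ^ (2 : ℝ)) hv.summable h4 hinj

/-- The weighted composition operator `(T v) i = w i * v (σ i)`. -/
def weightedComp (w : ℕ × ℤ → ℝ) (σ : ℕ × ℤ → ℕ × ℤ) (hw : ∀ i, |w i| ≤ 1)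
    (hσ : Set.InjOn σ {i | w i ≠ 0}) : K →L[ℂ] K :=
  LinearMap.mkContinuous
    { toFun := fun v => ⟨fun i => (w i : ℂ) * v (σ i),
        memℓp_gen (by simpa using (weightedComp_summable hw hσ v).1)⟩
      map_add' := fun v u => by
        ext i
        exact mul_add _ _ _
      map_smul' := fun c v => by
        ext i
        exact mul_left_comm _ _ _ } 1 (fun v => by
    rw [one_mul]
    refine (Real.rpow_le_rpow_iff (z := 2) (norm_nonneg _) (norm_nonneg _) (by norm_num)).mp ?_
    refine le_trans (le_of_eq ?_) (weightedComp_summable hw hσ v).2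
    simpa using lp.norm_rpow_eq_tsum (p := 2) (by norm_num)
      (⟨fun i => (w i : ℂ) * v (σ i),
        memℓp_gen (by simpa using (weightedComp_summable hw hσ v).1)⟩ : K))

lemma weightedComp_apply {w : ℕ × ℤ → ℝ} {σ : ℕ × ℤ → ℕ × ℤ} {hw : ∀ i, |w i| ≤ 1}
    {hσ : Set.InjOn σ {i | w i ≠ 0}} (v : K) (i : ℕ × ℤ) :
    weightedComp w σ hw hσ v i = (w i : ℂ) * v (σ i) := rfl

lemma star_weightedComp {w w' : ℕ × ℤ → ℝ} {σ σ' : ℕ × ℤ → ℕ × ℤ} {hw : ∀ i, |w i| ≤ 1}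
    {hw' : ∀ i, |w' i| ≤ 1} {hσ : Set.InjOn σ {i | w i ≠ 0}}
    {hσ' : Set.InjOn σ' {i | w' i ≠ 0}}
    (h : ∀ i, w i ≠ 0 → w' (σ i) = w i ∧ σ' (σ i) = i)
    (h' : ∀ i, w' i ≠ 0 → w (σ' i) = w' i ∧ σ (σ' i) = i) :
    star (weightedComp w σ hw hσ) = weightedComp w' σ' hw' hσ' := by
  symm
  rw [ContinuousLinearMap.star_eq_adjoint]
  refine (ContinuousLinearMap.eq_adjoint_iff _ _).mpr fun u v => ?_
  rw [lp.inner_eq_tsum, lp.inner_eq_tsum]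
  have hne : ∀ i, inner ℂ (weightedComp w' σ' hw' hσ' u i) (v i) ≠ 0 → w' i ≠ 0 := by
    intro i hi h0
    apply hi
    simp [weightedComp_apply, h0]
  have hne' : ∀ i, inner ℂ (u i) (weightedComp w σ hw hσ v i) ≠ 0 → w i ≠ 0 := by
    intro i hi h0
    apply hi
    simp [weightedComp_apply, h0]
  symm
  refine tsum_eq_tsum_of_ne_zero_bij (fun s => σ' s.1) ?_ ?_ ?_
  · intro s t hst
    exact Subtype.ext (hσ' (hne _ s.2) (hne _ t.2) hst)
  · intro i hi
    have hi' := h i (hne' i hi)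
    refine ⟨⟨σ i, ?_⟩, hi'.2⟩
    simp only [Function.mem_support, weightedComp_apply, hi'.1, hi'.2] at hi ⊢
    intro h0
    apply hi
    simp only [RCLike.inner_apply, map_mul, Complex.conj_ofReal] at h0 ⊢
    rw [← h0]
    ring
  · rintro ⟨i, hi⟩
    have hi' := h' i (hne i hi)
    simp only [weightedComp_apply, hi'.1, hi'.2, RCLike.inner_apply, map_mul, Complex.conj_ofReal]
    ring

lemma one_sub_pow_nonneg (q : Set.Ioo (0 : ℝ) 1) (k : ℕ) : 0 ≤ 1 - (q : ℝ) ^ k :=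
  sub_nonneg.mpr (pow_le_one₀ q.2.1.le q.2.2.le)

lemma abs_sqrt_one_sub_le (q : Set.Ioo (0 : ℝ) 1) (k : ℕ) :
    |√(1 - (q : ℝ) ^ k)| ≤ 1 := by
  rw [abs_of_nonneg (Real.sqrt_nonneg _)]
  exact Real.sqrt_le_one.mpr (by linarith [pow_pos q.2.1 k])

lemma abs_pow_le (q : Set.Ioo (0 : ℝ) 1) (k : ℕ) : |(q : ℝ) ^ k| ≤ 1 := by
  rw [abs_of_nonneg (pow_nonneg q.2.1.le k)]
  exact pow_le_one₀ q.2.1.le q.2.2.le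

/-- The operator with `a e_{k,j} = (1 - q^{2(k+1)})^{1/2} e_{k+1,j}`. -/
def opA (q : Set.Ioo (0 : ℝ) 1) : K →L[ℂ] K :=
  weightedComp (fun i => √(1 - (q : ℝ) ^ (2 * i.1))) (fun i => (i.1 - 1, i.2))
    (fun i => abs_sqrt_one_sub_le q _) (by
      rintro ⟨k, j⟩ hk ⟨l, m⟩ hl h
      have h0 : k ≠ 0 := by
        rintro rfl
        simp at hk
      have h1 : l ≠ 0 := by
        rintro rfl
        simp at hl
      simp only [Prod.mk.injEq] at h ⊢
      omega)

/-- The adjoint of `opA`. -/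
def opAstar (q : Set.Ioo (0 : ℝ) 1) : K →L[ℂ] K :=
  weightedComp (fun i => √(1 - (q : ℝ) ^ (2 * (i.1 + 1)))) (fun i => (i.1 + 1, i.2))
    (fun i => abs_sqrt_one_sub_le q _) (by
      rintro ⟨k, j⟩ hk ⟨l, m⟩ hl h
      simp only [Prod.mk.injEq] at h ⊢
      omega)

/-- The operator with `b e_{k,j} = q^k e_{k,j+1}`. -/
def opB (q : Set.Ioo (0 : ℝ) 1) : K →L[ℂ] K :=
  weightedComp (fun i => (q : ℝ) ^ i.1) (fun i => (i.1, i.2 - 1)) (fun i => abs_pow_le q _) (by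
      rintro ⟨k, j⟩ hk ⟨l, m⟩ hl h
      simp only [Prod.mk.injEq] at h ⊢
      omega)

/-- The adjoint of `opB`. -/
def opBstar (q : Set.Ioo (0 : ℝ) 1) : K →L[ℂ] K :=
  weightedComp (fun i => (q : ℝ) ^ i.1) (fun i => (i.1, i.2 + 1)) (fun i => abs_pow_le q _) (by
      rintro ⟨k, j⟩ hk ⟨l, m⟩ hl h
      simp only [Prod.mk.injEq] at h ⊢
      omega)

lemma star_opA (q : Set.Ioo (0 : ℝ) 1) : star (opA q) = opAstar q := by
  refine star_weightedComp ?_ ?_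
  · rintro ⟨k, j⟩ hk
    have h0 : k ≠ 0 := by
      rintro rfl
      simp at hk
    have h1 : k - 1 + 1 = k := by omega
    simp [h1]
  · rintro ⟨k, j⟩ hk
    simp

lemma star_opB (q : Set.Ioo (0 : ℝ) 1) : star (opB q) = opBstar q := by
  refine star_weightedComp ?_ ?_
  · rintro ⟨k, j⟩ hk
    simp
  · rintro ⟨k, j⟩ hk
    simp

lemma sq_sqrt_coe (q : Set.Ioo (0 : ℝ) 1) (k : ℕ) :
    ((√(1 - (q : ℝ) ^ k) : ℝ) : ℂ) * ((√(1 - (q : ℝ) ^ k) : ℝ) : ℂ)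
      = 1 - ((q : ℝ) : ℂ) ^ k := by
  rw [← Complex.ofReal_mul, Real.mul_self_sqrt (one_sub_pow_nonneg q k)]
  push_cast
  rfl

lemma isSUqPair_op (q : Set.Ioo (0 : ℝ) 1) : IsSUqPair (q : ℝ) (opA q) (opB q) where
  rel_ba := by
    ext v ⟨k, j⟩
    change ((q : ℝ) ^ k : ℝ) * (((√(1 - (q : ℝ) ^ (2 * k)) : ℝ) : ℂ) * v (k - 1, j - 1)) =
      ((q : ℝ) : ℂ) * (((√(1 - (q : ℝ) ^ (2 * k)) : ℝ) : ℂ) *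
        (((q : ℝ) ^ (k - 1) : ℝ) * v (k - 1, j - 1)))
    generalize (v (k - 1, j - 1) : ℂ) = c
    rcases k with _ | k
    · simp
    · push_cast
      ring
  rel_bstar_a := by
    rw [star_opB]
    ext v ⟨k, j⟩
    change ((q : ℝ) ^ k : ℝ) * (((√(1 - (q : ℝ) ^ (2 * k)) : ℝ) : ℂ) * v (k - 1, j + 1)) =
      ((q : ℝ) : ℂ) * (((√(1 - (q : ℝ) ^ (2 * k)) : ℝ) : ℂ) *
        (((q : ℝ) ^ (k - 1) : ℝ) * v (k - 1, j + 1)))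
    generalize (v (k - 1, j + 1) : ℂ) = c
    rcases k with _ | k
    · simp
    · push_cast
      ring
  normal_b := by
    rw [star_opB]
    ext v ⟨k, j⟩
    change ((q : ℝ) ^ k : ℝ) * (((q : ℝ) ^ k : ℝ) * v (k, j - 1 + 1)) =
      (((q : ℝ) ^ k : ℝ) : ℂ) * (((q : ℝ) ^ k : ℝ) * v (k, j + 1 - 1))
    simp
  left_unitary := by
    rw [star_opA, star_opB]
    ext v ⟨k, j⟩
    change ((√(1 - (q : ℝ) ^ (2 * (k + 1))) : ℝ) : ℂ) *
        (((√(1 - (q : ℝ) ^ (2 * (k + 1))) : ℝ) : ℂ) * v (k + 1 - 1, j)) +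
      ((q : ℝ) : ℂ) ^ 2 * ((((q : ℝ) ^ k : ℝ) : ℂ) * (((q : ℝ) ^ k : ℝ) * v (k, j - 1 + 1))) =
      v (k, j)
    rw [← mul_assoc, sq_sqrt_coe]
    push_cast
    simp only [sub_add_cancel]
    ring
  right_unitary := by
    rw [star_opA, star_opB]
    ext v ⟨k, j⟩
    change ((√(1 - (q : ℝ) ^ (2 * k)) : ℝ) : ℂ) *
        (((√(1 - (q : ℝ) ^ (2 * (k - 1 + 1))) : ℝ) : ℂ) * v (k - 1 + 1, j)) +
      (((q : ℝ) ^ k : ℝ) : ℂ) * (((q : ℝ) ^ k : ℝ) * v (k, j - 1 + 1)) = v (k, j)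
    rcases k with _ | k
    · simp
    · simp only [Nat.add_sub_cancel, sub_add_cancel]
      rw [← mul_assoc, sq_sqrt_coe]
      push_cast
      ring

/-- The representation of `SU_q(2)` on `K` given by `opA` and `opB`. -/
def rho (q : Set.Ioo (0 : ℝ) 1) : SU q →⋆ₐ[ℂ] (K →L[ℂ] K) :=
  evalRep ⟨(opA q, opB q), isSUqPair_op q⟩

lemma norm_rho_le (q : Set.Ioo (0 : ℝ) 1) (x : SU q) : ‖rho q x‖ ≤ ‖x‖ := norm_evalRep_le _ _

/-- The orthonormal vector `e_{k,0}` of `K`. -/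
def vec (k : ℕ) : K := lp.single 2 (k, (0 : ℤ)) (1 : ℂ)

lemma norm_vec (k : ℕ) : ‖vec k‖ = 1 := by
  simp [vec]

lemma haar_summable (q : Set.Ioo (0 : ℝ) 1) (x : SU q) :
    Summable fun k : ℕ => ((q : ℝ) : ℂ) ^ (2 * k) * ⟪vec k, rho q x (vec k)⟫_ℂ := by
  have hg : Summable fun k : ℕ => ((q : ℝ) ^ 2) ^ k * ‖x‖ :=
    (summable_geometric_of_lt_one (by positivity)
      (pow_lt_one₀ q.2.1.le q.2.2 two_ne_zero)).mul_right _
  refine hg.of_norm_bounded fun k => ?_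
  rw [norm_mul, norm_pow, Complex.norm_real, Real.norm_of_nonneg q.2.1.le, pow_mul]
  refine mul_le_mul_of_nonneg_left ?_ (pow_nonneg (pow_nonneg q.2.1.le _) _)
  refine (norm_inner_le_norm _ _).trans ?_
  rw [norm_vec, one_mul]
  refine ((rho q x).le_opNorm _).trans ?_
  rw [norm_vec, mul_one]
  exact norm_rho_le q x

/-- The Haar state `h x = (1 - q²) ∑ₖ q^{2k} ⟨e_{k,0}, x e_{k,0}⟩` of `SU_q(2)`
(Woronowicz' formula). -/
def haar (q : Set.Ioo (0 : ℝ) 1) : SU q →ₚ[ℂ] ℂ :=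
  PositiveLinearMap.mk₀
    { toFun := fun x => (1 - ((q : ℝ) : ℂ) ^ 2) *
        ∑' k : ℕ, ((q : ℝ) : ℂ) ^ (2 * k) * ⟪vec k, rho q x (vec k)⟫_ℂ
      map_add' := fun x y => by
        rw [← mul_add, ← (haar_summable q x).tsum_add (haar_summable q y)]
        simp [mul_add]
      map_smul' := fun c x => by
        simp only [map_smul, smul_apply, inner_smul_right, RingHom.id_apply,
          smul_eq_mul, mul_left_comm _ c, tsum_mul_left] } (by
    intro x hx
    obtain ⟨y, rfl⟩ := CStarAlgebra.nonneg_iff_eq_star_mul_self.mp hx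
    change 0 ≤ (1 - ((q : ℝ) : ℂ) ^ 2) *
        ∑' k : ℕ, ((q : ℝ) : ℂ) ^ (2 * k) * ⟪vec k, rho q (star y * y) (vec k)⟫_ℂ
    have h1 : (0 : ℂ) ≤ 1 - ((q : ℝ) : ℂ) ^ 2 := by
      exact_mod_cast one_sub_pow_nonneg q 2
    refine mul_nonneg h1 (tsum_nonneg fun k => mul_nonneg ?_ ?_)
    · exact_mod_cast pow_nonneg q.2.1.le (2 * k)
    · rw [map_mul, map_star, mul_apply_eq_comp, ContinuousLinearMap.star_eq_adjoint,
        ContinuousLinearMap.adjoint_inner_right, inner_self_eq_norm_sq_to_K]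
      exact pow_nonneg ((RCLike.ofReal_nonneg (K := ℂ)).mpr (norm_nonneg _)) 2)

lemma haar_apply (q : Set.Ioo (0 : ℝ) 1) (x : SU q) : haar q x = (1 - ((q : ℝ) : ℂ) ^ 2) *
    ∑' k : ℕ, ((q : ℝ) : ℂ) ^ (2 * k) * ⟪vec k, rho q x (vec k)⟫_ℂ := rfl

/-! ### The Hilbert spaces `H_h`, `H_+`, `H_-` -/

/-- The completion of `SU_q(2)` for the inner product `⟨x, y⟩ = h (x* y)`. -/
abbrev Hh (q : Set.Ioo (0 : ℝ) 1) : Type := (haar q).GNS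

/-- The canonical map from `SU_q(2)` to `H_h`. -/
def toHh (q : Set.Ioo (0 : ℝ) 1) : SU q →ₗ[ℂ] Hh q :=
  (UniformSpace.Completion.toComplL (𝕜 := ℂ) (E := (haar q).PreGNS)).toLinearMap ∘ₗ
    (haar q).toPreGNS.toLinearMap

/-- Left multiplication of `SU_q(2)` on `H_h`. -/
def leftMul (q : Set.Ioo (0 : ℝ) 1) : SU q →⋆ₐ[ℂ] (Hh q →L[ℂ] Hh q) := (haar q).gnsStarAlgHom

lemma leftMul_toHh (q : Set.Ioo (0 : ℝ) 1) (x y : SU q) :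
    leftMul q x (toHh q y) = toHh q (x * y) :=
  (haar q).gnsNonUnitalStarAlgHom_apply_coe

/-- The graph of the automorphism `∂_k` of the coordinate algebra of `SU_q(2)`, which is
determined by its values `q^{1/2} a`, `q^{1/2} b`, `q^{-1/2} a*`, `q^{-1/2} b*` at the
generators `a`, `b`, `a*`, `b*`. -/
def delKGraph (q : Set.Ioo (0 : ℝ) 1) : Subalgebra ℂ (SU q × SU q) :=
  Algebra.adjoin ℂ
    {(gena q, ((√(q : ℝ) : ℝ) : ℂ) • gena q),
      (genb q, ((√(q : ℝ) : ℝ) : ℂ) • genb q),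
      (star (gena q), (((√(q : ℝ))⁻¹ : ℝ) : ℂ) • star (gena q)),
      (star (genb q), (((√(q : ℝ))⁻¹ : ℝ) : ℂ) • star (genb q))}

/-- The space `A_n` of all `x` in the coordinate algebra with `∂_k x = q^{n/2} x`. -/
def homog (q : Set.Ioo (0 : ℝ) 1) (n : ℤ) : Submodule ℂ (SU q) where
  carrier := {x | (x, (((q : ℝ) ^ ((n : ℝ) / 2) : ℝ) : ℂ) • x) ∈ delKGraph q}
  zero_mem' := by
    change (0, _ • 0) ∈ delKGraph q
    rw [smul_zero]
    exact (delKGraph q).zero_mem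
  add_mem' {x y} hx hy := by
    have h := (delKGraph q).add_mem hx hy
    rw [Prod.mk_add_mk, ← smul_add] at h
    exact h
  smul_mem' c x hx := by
    have h := (delKGraph q).smul_mem hx c
    rw [Prod.smul_mk, smul_comm] at h
    exact h

lemma homog_mul {q : Set.Ioo (0 : ℝ) 1} {m n : ℤ} {x y : SU q} (hx : x ∈ homog q m)
    (hy : y ∈ homog q n) : x * y ∈ homog q (m + n) := by
  have h := (delKGraph q).mul_mem hx hy
  have he : (((q : ℝ) ^ (((m + n : ℤ) : ℝ) / 2) : ℝ) : ℂ) =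
      (((q : ℝ) ^ ((m : ℝ) / 2) : ℝ) : ℂ) * (((q : ℝ) ^ ((n : ℝ) / 2) : ℝ) : ℂ) := by
    rw [← Complex.ofReal_mul, ← Real.rpow_add q.2.1]
    push_cast
    ring_nf
  change (x * y, _ • (x * y)) ∈ delKGraph q
  rw [he]
  rw [Prod.mk_mul_mk, smul_mul_smul_comm] at h
  exact h

lemma homog_one (q : Set.Ioo (0 : ℝ) 1) : (1 : SU q) ∈ homog q 0 := by
  change (1, (((q : ℝ) ^ (((0 : ℤ) : ℝ) / 2) : ℝ) : ℂ) • (1 : SU q)) ∈ delKGraph q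
  rw [Int.cast_zero, zero_div, Real.rpow_zero, Complex.ofReal_one, one_smul]
  exact (delKGraph q).one_mem

lemma gena_mem_homog (q : Set.Ioo (0 : ℝ) 1) : gena q ∈ homog q 1 := by
  change (gena q, _ • gena q) ∈ delKGraph q
  apply Algebra.subset_adjoin
  simp [Real.sqrt_eq_rpow]

lemma genb_mem_homog (q : Set.Ioo (0 : ℝ) 1) : genb q ∈ homog q 1 := by
  change (genb q, _ • genb q) ∈ delKGraph q
  apply Algebra.subset_adjoin
  simp [Real.sqrt_eq_rpow]

lemma rpow_neg_half (q : Set.Ioo (0 : ℝ) 1) :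
    (q : ℝ) ^ (((-1 : ℤ) : ℝ) / 2) = (√(q : ℝ))⁻¹ := by
  rw [Real.sqrt_eq_rpow, ← Real.rpow_neg q.2.1.le]
  norm_num

lemma star_gena_mem_homog (q : Set.Ioo (0 : ℝ) 1) : star (gena q) ∈ homog q (-1) := by
  change (star (gena q), _ • star (gena q)) ∈ delKGraph q
  rw [rpow_neg_half]
  apply Algebra.subset_adjoin
  simp

lemma star_genb_mem_homog (q : Set.Ioo (0 : ℝ) 1) : star (genb q) ∈ homog q (-1) := by
  change (star (genb q), _ • star (genb q)) ∈ delKGraph q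
  rw [rpow_neg_half]
  apply Algebra.subset_adjoin
  simp

/-- The closure of `A_n` in `H_h`. -/
def Hn (q : Set.Ioo (0 : ℝ) 1) (n : ℤ) : Submodule ℂ (Hh q) :=
  ((homog q n).map (toHh q)).topologicalClosure

/-- The Hilbert space `H_+`. -/
abbrev Hplus (q : Set.Ioo (0 : ℝ) 1) : Submodule ℂ (Hh q) := Hn q 1

/-- The Hilbert space `H_-`. -/
abbrev Hminus (q : Set.Ioo (0 : ℝ) 1) : Submodule ℂ (Hh q) := Hn q (-1)

/-! ### The standard Podles sphere -/

/-- The standard Podles sphere `S_q^2`, the C*-subalgebra of `SU_q(2)` generated by `b* b` and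
`a b*`. -/
def Sphere (q : Set.Ioo (0 : ℝ) 1) : StarSubalgebra ℂ (SU q) :=
  (StarAlgebra.adjoin ℂ {star (genb q) * genb q, gena q * star (genb q)}).topologicalClosure

instance (q : Set.Ioo (0 : ℝ) 1) : IsClosed (Sphere q : Set (SU q)) :=
  StarSubalgebra.isClosed_topologicalClosure _

/-- The element `A = b* b`. -/
def elA (q : Set.Ioo (0 : ℝ) 1) : Sphere q :=
  ⟨star (genb q) * genb q,
    StarSubalgebra.le_topologicalClosure _ (StarAlgebra.subset_adjoin ℂ _ (by simp))⟩

/-- The element `B = a b*`. -/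
def elB (q : Set.Ioo (0 : ℝ) 1) : Sphere q :=
  ⟨gena q * star (genb q),
    StarSubalgebra.le_topologicalClosure _ (StarAlgebra.subset_adjoin ℂ _ (by simp))⟩

lemma homog_zero_mul_mem {q : Set.Ioo (0 : ℝ) 1} {n : ℤ} {x y : SU q} (hx : x ∈ homog q 0)
    (hy : y ∈ homog q n) : x * y ∈ homog q n := by
  simpa using homog_mul hx hy

lemma coordinate_le_homog_zero {q : Set.Ioo (0 : ℝ) 1} {x : SU q}
    (hx : x ∈ StarAlgebra.adjoin ℂ {star (genb q) * genb q, gena q * star (genb q)}) :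
    x ∈ homog q 0 ∧ star x ∈ homog q 0 := by
  have hA : star (genb q) * genb q ∈ homog q 0 := by
    simpa using homog_mul (star_genb_mem_homog q) (genb_mem_homog q)
  have hB : gena q * star (genb q) ∈ homog q 0 := by
    simpa using homog_mul (gena_mem_homog q) (star_genb_mem_homog q)
  have hB' : genb q * star (gena q) ∈ homog q 0 := by
    simpa using homog_mul (genb_mem_homog q) (star_gena_mem_homog q)
  induction hx using StarAlgebra.adjoin_induction with
  | mem x hx =>
    rcases hx with rfl | rfl
    · simpa using hA
    · simpa using And.intro hB hB'
  | algebraMap c =>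
    rw [Algebra.algebraMap_eq_smul_one]
    simpa using And.intro ((homog q 0).smul_mem c (homog_one q))
      ((homog q 0).smul_mem (star c) (homog_one q))
  | add x y _ _ hx hy =>
    rw [star_add]
    exact ⟨add_mem hx.1 hy.1, add_mem hx.2 hy.2⟩
  | mul x y _ _ hx hy =>
    rw [star_mul]
    exact ⟨homog_zero_mul_mem hx.1 hy.1, homog_zero_mul_mem hy.2 hx.2⟩
  | star x _ hx =>
    rw [star_star]
    exact ⟨hx.2, hx.1⟩

lemma leftMul_mem_Hn {q : Set.Ioo (0 : ℝ) 1} {n : ℤ} (x : Sphere q) {v : Hh q}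
    (hv : v ∈ Hn q n) : leftMul q (x : SU q) v ∈ Hn q n := by
  have hcl : IsClosed (Hn q n : Set (Hh q)) := Submodule.isClosed_topologicalClosure _
  have h1 : ∀ y ∈ homog q n, leftMul q (x : SU q) (toHh q y) ∈ Hn q n := by
    intro y hy
    rw [leftMul_toHh]
    have hcont : Continuous fun z : SU q => toHh q (z * y) := by
      have : (fun z : SU q => toHh q (z * y)) = fun z => leftMul q z (toHh q y) := by
        funext z
        rw [leftMul_toHh]
      rw [this]
      have h2 : Continuous (leftMul q) := map_continuous (leftMul q)
      exact h2.clm_apply continuous_const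
    refine closure_minimal (s := (StarAlgebra.adjoin ℂ
      {star (genb q) * genb q, gena q * star (genb q)} : Set (SU q))) ?_
      (hcl.preimage hcont) x.2
    intro z hz
    exact Submodule.le_topologicalClosure _
      (Submodule.mem_map_of_mem (homog_zero_mul_mem (coordinate_le_homog_zero hz).1 hy))
  refine closure_minimal (s := ((homog q n).map (toHh q) : Set (Hh q))) ?_
    (hcl.preimage (leftMul q (x : SU q)).continuous) hv
  rintro _ ⟨y, hy, rfl⟩
  exact h1 y hy

/-- Left multiplication of the Podles sphere on `H_n`. -/
def sphereMul (q : Set.Ioo (0 : ℝ) 1) (n : ℤ) (x : Sphere q) : Hn q n →L[ℂ] Hn q n :=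
  ((leftMul q (x : SU q)).comp (Hn q n).subtypeL).codRestrict (Hn q n)
    (fun v => leftMul_mem_Hn x v.2)

/-! ### Spectral projections, matrix units and fibres -/

/-- The spectral projection `χ_{{q^{2k}}}(A)`. -/
def chiPt (q : Set.Ioo (0 : ℝ) 1) (k : ℕ) : Sphere q :=
  cfc (Set.indicator {(q : ℝ) ^ (2 * k)} (1 : ℝ → ℝ)) (elA q)

/-- The spectral projection `χ_{[0, q^{2k}]}(A)`. -/
def chiIcc (q : Set.Ioo (0 : ℝ) 1) (k : ℕ) : Sphere q :=
  cfc (Set.indicator (Set.Icc 0 ((q : ℝ) ^ (2 * k))) (1 : ℝ → ℝ)) (elA q)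

/-- The normalizing constants `C_{n,k}`. -/
def normC (q : Set.Ioo (0 : ℝ) 1) (n k : ℕ) : ℝ :=
  ∏ j ∈ Finset.Ico (min n k) (max n k), (q : ℝ) ^ (2 * j) * (1 - (q : ℝ) ^ (2 * (j + 1)))

/-- The matrix units `f_{n,k}`. -/
def matUnit (q : Set.Ioo (0 : ℝ) 1) (n k : ℕ) : Sphere q :=
  (((√(normC q n k))⁻¹ : ℝ) : ℂ) •
    if k ≤ n then elB q ^ (n - k) * chiPt q k else star (elB q) ^ (k - n) * chiPt q k

/-- The fibre `Y_k = S_q^2 χ_{{q^{2k}}}(A)`. -/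
def fibre (q : Set.Ioo (0 : ℝ) 1) (k : ℕ) : Submodule ℂ (Sphere q) :=
  LinearMap.range (LinearMap.mulRight ℂ (chiPt q k))

/-! ### The operators on the fibres

An element `y` of `Y_k` has an expansion `y = ∑ₙ λₙ f_{n,k}`, and
`f_{p,n} * y = λₙ f_{p,k}`, `f_{p,n} * y * f_{k,l} = λₙ f_{p,l}`. -/

/-- The vertical shift `Y_k → Y_k`, `f_{n,k} ↦ f_{n+1,k}`. -/
def shiftV (q : Set.Ioo (0 : ℝ) 1) (y : Sphere q) : Sphere q :=
  ∑' n : ℕ, matUnit q (n + 1) n * y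

/-- The horizontal shift `Y_k → Y_{k+1}`, `f_{n,k} ↦ f_{n+1,k+1}`. -/
def shiftH (q : Set.Ioo (0 : ℝ) 1) (k : ℕ) (y : Sphere q) : Sphere q :=
  ∑' n : ℕ, matUnit q (n + 1) n * y * matUnit q k (k + 1)

/-- The adjoint `Y_{k+1} → Y_k` of the horizontal shift, `f_{n+1,k+1} ↦ f_{n,k}` and
`f_{0,k+1} ↦ 0`. -/
def shiftHAdj (q : Set.Ioo (0 : ℝ) 1) (k : ℕ) (y : Sphere q) : Sphere q :=
  ∑' n : ℕ, matUnit q n (n + 1) * y * matUnit q (k + 1) k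

/-- The diagonal operator `Γ` on `Y_k`. -/
def opGamma (q : Set.Ioo (0 : ℝ) 1) (k : ℕ) (y : Sphere q) : Sphere q :=
  ∑' n : ℕ, if k + 1 ≤ n then
    (((q : ℝ) ^ (n - k - 1) *
      √((1 - (q : ℝ) ^ (2 * (k + 1))) / (1 - (q : ℝ) ^ (2 * n))) : ℝ) : ℂ) •
        (matUnit q n n * y)
    else 0

/-- The diagonal operator `Δ` on `Y_k`, for `k ≥ 1`. -/
def opDelta (q : Set.Ioo (0 : ℝ) 1) (k : ℕ) (y : Sphere q) : Sphere q :=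
  ∑' n : ℕ, if 0 < n ∧ n ≤ k then
    (((q : ℝ) ^ (k - n + 1) *
      √((1 - (q : ℝ) ^ (2 * (n - 1))) / (1 - (q : ℝ) ^ (2 * k))) : ℝ) : ℂ) •
        (matUnit q n n * y)
    else 0

/-- The orthogonal projection `P` on `Y_k` onto the span of `f_{0,k}, …, f_{k,k}`. -/
def opP (q : Set.Ioo (0 : ℝ) 1) (k : ℕ) (y : Sphere q) : Sphere q :=
  ∑ n ∈ Finset.range (k + 1), matUnit q n n * y

/-- The power `(S^H Γ)^j`, mapping `Y_l` to `Y_{l+j}`. -/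
def powUp (q : Set.Ioo (0 : ℝ) 1) (l : ℕ) : ℕ → Sphere q → Sphere q
  | 0, y => y
  | j + 1, y => shiftH q (l + j) (opGamma q (l + j) (powUp q l j y))

/-- The power `((S^H)* Δ)^j`, mapping `Y_{p+j}` to `Y_p`. -/
def powDown (q : Set.Ioo (0 : ℝ) 1) (p : ℕ) : ℕ → Sphere q → Sphere q
  | 0, y => y
  | j + 1, y => powDown q p j (shiftHAdj q (p + j) (opDelta q (p + j + 1) y))

/-! ### The quantum integral -/

/-- The statement that `y` is an element of `Y_k` and that the operator `ξ χ_{{q^{2k}}}(A)` from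
`H_+` to `H_-` is left multiplication by `y (b*)²`. -/
def IsFibrePart {q : Set.Ioo (0 : ℝ) 1} (ξ : Hplus q →L[ℂ] Hminus q) (k : ℕ)
    (y : Sphere q) : Prop :=
  y ∈ fibre q k ∧ ∀ v : Hplus q, (ξ (sphereMul q 1 (chiPt q k) v) : Hh q) =
    leftMul q ((y : SU q) * star (genb q) ^ 2) (v : Hh q)

lemma IsFibrePart.zero {q : Set.Ioo (0 : ℝ) 1} (k : ℕ) : IsFibrePart (q := q) 0 k 0 := by
  refine ⟨zero_mem _, fun v => ?_⟩
  have e : ((0 : Sphere q) : SU q) * star (genb q) ^ 2 = 0 := zero_mul _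
  rw [e, map_zero]
  rfl

lemma IsFibrePart.add {q : Set.Ioo (0 : ℝ) 1} {ξ η : Hplus q →L[ℂ] Hminus q} {k : ℕ}
    {y z : Sphere q} (h : IsFibrePart ξ k y) (h' : IsFibrePart η k z) :
    IsFibrePart (ξ + η) k (y + z) := by
  refine ⟨add_mem h.1 h'.1, fun v => ?_⟩
  have e : ((y + z : Sphere q) : SU q) * star (genb q) ^ 2 =
      (y : SU q) * star (genb q) ^ 2 + z * star (genb q) ^ 2 := add_mul _ _ _
  have e2 := map_add (leftMul q) ((y : SU q) * star (genb q) ^ 2) (z * star (genb q) ^ 2)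
  rw [e, e2]
  exact congrArg₂ (· + ·) (h.2 v) (h'.2 v)

lemma IsFibrePart.smul {q : Set.Ioo (0 : ℝ) 1} {ξ : Hplus q →L[ℂ] Hminus q} {k : ℕ}
    {y : Sphere q} (c : ℂ) (h : IsFibrePart ξ k y) : IsFibrePart (c • ξ) k (c • y) := by
  refine ⟨Submodule.smul_mem _ c h.1, fun v => ?_⟩
  have e : ((c • y : Sphere q) : SU q) * star (genb q) ^ 2 =
      c • ((y : SU q) * star (genb q) ^ 2) := smul_mul_assoc _ _ _
  have e2 := map_smul (leftMul q) c ((y : SU q) * star (genb q) ^ 2)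
  rw [e, e2]
  exact congrArg (c • ·) (h.2 v)

/-- The space `X` of all bounded operators `ξ : H_+ → H_-` such that, for all `k`, the operator
`ξ χ_{{q^{2k}}}(A)` is (left multiplication by) an element of `Y_k (b*)²`. -/
def X (q : Set.Ioo (0 : ℝ) 1) : Submodule ℂ (Hplus q →L[ℂ] Hminus q) where
  carrier := {ξ | ∀ k : ℕ, ∃ y : Sphere q, IsFibrePart ξ k y}
  zero_mem' k := ⟨0, IsFibrePart.zero k⟩
  add_mem' hξ hη k := ⟨_, (hξ k).choose_spec.add (hη k).choose_spec⟩
  smul_mem' c _ hξ k := ⟨_, (hξ k).choose_spec.smul c⟩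

/-- The element `y` of `Y_k` with `ξ χ_{{q^{2k}}}(A) = y (b*)²`. -/
def fibrePart {q : Set.Ioo (0 : ℝ) 1} (ξ : X q) (k : ℕ) : Sphere q := (ξ.2 k).choose

lemma bstar_sq_mul_b_sq (q : ℝ) :
    star (genb q) ^ 2 * genb q ^ 2 = (star (genb q) * genb q) ^ 2 := by
  have hn : Commute (star (genb q)) (genb q) := (isSUqPair_gen q).normal_b.symm
  exact (hn.mul_pow 2).symm

lemma mul_bstar_sq_mul_b_sq_mem {q : Set.Ioo (0 : ℝ) 1} (y : Sphere q) :
    (y : SU q) * star (genb q) ^ 2 * genb q ^ 2 ∈ Sphere q := by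
  rw [mul_assoc, bstar_sq_mul_b_sq]
  exact mul_mem y.2 (pow_mem (elA q).2 2)

/-- The element `ξ χ_{{q^{2l}}}(A) b² q^{-2l}` of `Y_l`. -/
def integrand {q : Set.Ioo (0 : ℝ) 1} (ξ : X q) (l : ℕ) : Sphere q :=
  ((((q : ℝ) ^ (2 * l))⁻¹ : ℝ) : ℂ) •
    ⟨(fibrePart ξ l : SU q) * star (genb q) ^ 2 * genb q ^ 2, mul_bstar_sq_mul_b_sq_mem _⟩

/-- The factor `q^m (1 - q²) (1 - q^{2(m+1)})^{-1/2}`. -/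
def weight (q : Set.Ioo (0 : ℝ) 1) (m : ℕ) : ℝ :=
  (q : ℝ) ^ m * ((1 - (q : ℝ) ^ 2) / √(1 - (q : ℝ) ^ (2 * (m + 1))))

/-- The `m`-th term of the series of the vertical integral. -/
def vertTerm {q : Set.Ioo (0 : ℝ) 1} (ξ : X q) (m : ℕ) : Sphere q :=
  (weight q m : ℂ) • ∑ l ∈ Finset.range (m + 1),
    opGamma q m (powUp q l (m - l) (shiftV q (integrand ξ l)))

/-- The quantum vertical integral. -/
def integralV {q : Set.Ioo (0 : ℝ) 1} (ξ : X q) : Sphere q := -∑' m : ℕ, vertTerm ξ m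

/-- The term of the horizontal integral with outer index `m` and inner index `l = m + 1 + j`. -/
def horInner {q : Set.Ioo (0 : ℝ) 1} (ξ : X q) (m j : ℕ) : Sphere q :=
  shiftHAdj q m (powDown q (m + 1) j (opP q (m + 1 + j) (shiftV q (integrand ξ (m + 1 + j)))))

/-- The `m`-th term of the series of the horizontal integral. -/
def horTerm {q : Set.Ioo (0 : ℝ) 1} (ξ : X q) (m : ℕ) : Sphere q :=
  (weight q m : ℂ) • ∑' j : ℕ, horInner ξ m j

/-- The quantum horizontal integral. -/
def integralH {q : Set.Ioo (0 : ℝ) 1} (ξ : X q) : Sphere q := ∑' m : ℕ, horTerm ξ m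

/-- The quantum integral `∫ = ∫^V + ∫^H : X → S_q^2`. -/
def integral {q : Set.Ioo (0 : ℝ) 1} (ξ : X q) : Sphere q := integralV ξ + integralH ξ

end

end Podles

namespace Podles

open scoped ComplexOrder ENNReal InnerProductSpace

noncomputable section

/-! ### The spectrum of `A` -/

/-! The bound is a geometric-series estimate: every operator entering the integral is a contraction
for the C*-norm. The finite sums of matrix units behind `shiftV`, `shiftH` and `shiftHAdj` are
partial isometries (`norm_sum_matUnit_succ_left_le`, `norm_sum_matUnit_succ_right_le`), and
`opGamma`, `opDelta`, `opP` are left multiplications by combinations of the orthogonal projections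
`chiPt q n` (`norm_sum_smul_chiPt_le`). So the Hilbert space structure of the fibres is never used.
`opDelta` even has norm at most q, and the weights are at most q^m. Hence the m-th vertical term is
at most (m+1) q^m ‖ξ‖ and the m-th horizontal term at most q^m (1-q)⁻¹ ‖ξ‖. Both lie in Y_m, so the
cut-off to [0, q^{2k}] kills all m < k, and the remaining tail sums to q^k (k+2-kq)/(1-q)² times
‖ξ‖.

The substantial point is `norm_integrand_le`: the operator norm of ξ controls the C*-norm of its
fibre parts. If ξ χ_k is left multiplication by y (b*)², minimality of χ_k gives y*y = c χ_k, and
evaluating ξ on the single vector χ_k b of H_+ yields q^{2k} ‖y‖ ≤ ‖ξ‖. Minimality rests on A B = q²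
B A: B and B* shift the eigenspaces of A, so no nontrivial word in them returns to χ_k except as a
scalar. Of the spectrum of A only the inclusion in {0} ∪ {q^{2k}} is needed; it makes the relevant
indicator functions continuous on the spectrum. -/

lemma a_mul_star_a (q : ℝ) : gena q * star (gena q) = 1 - star (genb q) * genb q := by
  rw [← (isSUqPair_gen q).right_unitary, (isSUqPair_gen q).normal_b, add_sub_cancel_right]

lemma star_a_mul_a (q : ℝ) :
    star (gena q) * gena q = 1 - ((q : ℂ) ^ 2) • (star (genb q) * genb q) := by
  rw [← (isSUqPair_gen q).left_unitary, (isSUqPair_gen q).normal_b, add_sub_cancel_right]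

lemma mem_spectrum_iff_one_sub {q r : ℝ} :
    ((r : ℝ) : ℂ) ∈ spectrum ℂ (star (genb q) * genb q) ↔
      ((1 - r : ℝ) : ℂ) ∈ spectrum ℂ (gena q * star (gena q)) := by
  rw [spectrum.mem_iff, spectrum.mem_iff, a_mul_star_a, ← IsUnit.neg_iff]
  rw [Complex.ofReal_sub, Complex.ofReal_one, map_sub, map_one]
  congr! 2
  abel

lemma nonneg_of_mem_spectrum {q r : ℝ}
    (h : ((r : ℝ) : ℂ) ∈ spectrum ℂ (star (genb q) * genb q)) : 0 ≤ r :=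
  spectrum_star_mul_self_nonneg r ((spectrum.algebraMap_mem_iff ℂ).mp h)

lemma le_one_of_mem_spectrum {q r : ℝ}
    (h : ((r : ℝ) : ℂ) ∈ spectrum ℂ (star (genb q) * genb q)) : r ≤ 1 := by
  have h1 := mem_spectrum_iff_one_sub.mp h
  nth_rewrite 1 [← star_star (gena q)] at h1
  have h2 : 0 ≤ 1 - r :=
    spectrum_star_mul_self_nonneg _ ((spectrum.algebraMap_mem_iff ℂ).mp h1)
  linarith

/-- The products a a* = 1 - A and a* a = 1 - q² A have the same nonzero spectrum, and r ≠ 1 makes 1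
- r nonzero. -/
lemma div_mem_spectrum {q r : ℝ} (hq : q ≠ 0) (hr : r ≠ 1)
    (h : ((r : ℝ) : ℂ) ∈ spectrum ℂ (star (genb q) * genb q)) :
    ((r / q ^ 2 : ℝ) : ℂ) ∈ spectrum ℂ (star (genb q) * genb q) := by
  have h1 : ((1 - r : ℝ) : ℂ) ∈ spectrum ℂ (gena q * star (gena q)) \ {0} :=
    ⟨mem_spectrum_iff_one_sub.mp h, by
      simpa [sub_eq_zero] using fun h => hr (by exact_mod_cast h.symm)⟩
  rw [spectrum.nonzero_mul_comm] at h1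
  have h2 := h1.1
  -- The identity used is -q² (r/q² - A) = (1 - r) - (1 - q² A), so both sides are invertible
  -- together.
  have hq2 : IsUnit (algebraMap ℂ (SU q) (-(q : ℂ) ^ 2)) :=
    (isUnit_iff_ne_zero.mpr (by simpa using hq)).map _
  rw [spectrum.mem_iff, star_a_mul_a] at h2
  rw [spectrum.mem_iff]
  intro hu
  apply h2
  have h3 := hq2.mul hu
  rw [mul_sub, ← map_mul, ← Algebra.smul_def] at h3
  have h4 : -(q : ℂ) ^ 2 * ((r / q ^ 2 : ℝ) : ℂ) = -r := by
    have : (q : ℂ) ≠ 0 := by exact_mod_cast hq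
    push_cast
    field_simp
  rw [h4] at h3
  convert h3 using 1
  rw [Complex.ofReal_sub, Complex.ofReal_one, map_sub, map_one, map_neg, neg_smul]
  abel

lemma coe_elA (q : Set.Ioo (0 : ℝ) 1) : (elA q : SU q) = star (genb q) * genb q := rfl

/-- Spectral permanence for the closed *-subalgebra `Sphere q`; it is needed because the spectral
argument uses a, an element of the larger algebra. -/
lemma ofReal_mem_spectrum (q : Set.Ioo (0 : ℝ) 1) {r : ℝ} (hr : r ∈ spectrum ℝ (elA q)) :
    ((r : ℝ) : ℂ) ∈ spectrum ℂ (star (genb (q : ℝ)) * genb q) := by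
  have h := (spectrum.algebraMap_mem_iff (S := ℂ) (a := elA q) (r := r)).mpr hr
  rw [StarSubalgebra.mem_spectrum_iff (Sphere q), coe_elA] at h
  exact h

/-- If r is no power of q², division by q² can be repeated forever inside the spectrum. All r /
q^{2k} are then at most 1, which forces r ≤ 0. -/
lemma spectrum_elA_subset (q : Set.Ioo (0 : ℝ) 1) {r : ℝ} (hr : r ∈ spectrum ℝ (elA q)) :
    r = 0 ∨ ∃ k : ℕ, r = (q : ℝ) ^ (2 * k) := by
  have h := ofReal_mem_spectrum q hr
  by_contra! hne
  have hq : (q : ℝ) ≠ 0 := q.2.1.ne'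
  have hmem : ∀ k : ℕ, ((r / (q : ℝ) ^ (2 * k) : ℝ) : ℂ) ∈
      spectrum ℂ (star (genb (q : ℝ)) * genb q) := by
    intro k
    induction k with
    | zero => simpa using h
    | succ k ih =>
      have h1 : r / (q : ℝ) ^ (2 * k) ≠ 1 := fun h =>
        hne.2 k ((div_eq_one_iff_eq (pow_ne_zero _ hq)).mp h)
      have h2 := div_mem_spectrum hq h1 ih
      rwa [div_div, ← pow_add] at h2
  have hle : ∀ k : ℕ, r ≤ ((q : ℝ) ^ 2) ^ k := fun k => by
    have h1 := le_one_of_mem_spectrum (hmem k)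
    rwa [div_le_one (pow_pos q.2.1 _), pow_mul] at h1
  have hlim := tendsto_pow_atTop_nhds_zero_of_lt_one (pow_nonneg q.2.1.le 2)
    (pow_lt_one₀ q.2.1.le q.2.2 two_ne_zero)
  exact hne.1 (le_antisymm (ge_of_tendsto' hlim hle) (nonneg_of_mem_spectrum h))

lemma isSelfAdjoint_elA (q : Set.Ioo (0 : ℝ) 1) : IsSelfAdjoint (elA q) :=
  Subtype.ext (IsSelfAdjoint.star_mul_self (genb (q : ℝ)))

lemma spectrum_elA_nonneg (q : Set.Ioo (0 : ℝ) 1) {r : ℝ} (hr : r ∈ spectrum ℝ (elA q)) :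
    0 ≤ r := by
  rcases spectrum_elA_subset q hr with rfl | ⟨k, rfl⟩
  · exact le_rfl
  · exact pow_nonneg q.2.1.le _

lemma even_pow_injective (q : Set.Ioo (0 : ℝ) 1) {j k : ℕ}
    (h : (q : ℝ) ^ (2 * j) = (q : ℝ) ^ (2 * k)) : j = k := by
  have := pow_right_injective₀ q.2.1 q.2.2.ne h
  omega

/-- The non-zero points of the spectrum of `A` are isolated. -/
lemma continuousOn_spectrum_elA (q : Set.Ioo (0 : ℝ) 1) {f : ℝ → ℝ}
    (hf : ContinuousWithinAt f (Set.Ici 0) 0) : ContinuousOn f (spectrum ℝ (elA q)) := by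
  intro x hx
  rcases spectrum_elA_subset q hx with rfl | ⟨k, rfl⟩
  · exact hf.mono fun r hr => spectrum_elA_nonneg q hr
  · have hU : Set.Ioo ((q : ℝ) ^ (2 * (k + 1))) ((q : ℝ) ^ (2 * k) / (q : ℝ) ^ 2) ∈
        nhds ((q : ℝ) ^ (2 * k)) := by
      have hp := pow_pos q.2.1 (2 * k)
      have h2 : (q : ℝ) ^ 2 < 1 := pow_lt_one₀ q.2.1.le q.2.2 two_ne_zero
      refine Ioo_mem_nhds ?_ ?_
      · rw [mul_add, pow_add, mul_one]
        nlinarith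
      · rw [lt_div_iff₀ (pow_pos q.2.1 2)]
        nlinarith
    have hc : ContinuousWithinAt f (spectrum ℝ (elA q) ∩
        Set.Ioo ((q : ℝ) ^ (2 * (k + 1))) ((q : ℝ) ^ (2 * k) / (q : ℝ) ^ 2))
        ((q : ℝ) ^ (2 * k)) := by
      refine continuousWithinAt_singleton.mono ?_
      rintro r ⟨hr, h1, h2⟩
      rcases spectrum_elA_subset q hr with rfl | ⟨j, rfl⟩
      · exact absurd h1 (not_lt.mpr (pow_nonneg q.2.1.le _))
      · rw [lt_div_iff₀ (pow_pos q.2.1 2), ← pow_add] at h2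
        rw [pow_lt_pow_iff_right_of_lt_one₀ q.2.1 q.2.2] at h1 h2
        have : j = k := by omega
        rw [this]
        rfl
    exact (continuousWithinAt_inter hU).mp hc

/-! ### The spectral projections -/

lemma eventually_ne_even_pow (q : Set.Ioo (0 : ℝ) 1) (k : ℕ) :
    ∀ᶠ x : ℝ in nhdsWithin 0 (Set.Ici 0), x ≠ (q : ℝ) ^ (2 * k) :=
  (eventually_ne_nhds (pow_pos q.2.1 (2 * k)).ne).filter_mono nhdsWithin_le_nhds

/-- Continuity matters because `cfc` defaults to 0 on functions that are not continuous on the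
spectrum. Only the point 0 needs checking, and there the indicator is locally constant. -/
lemma continuousOn_indicator_singleton (q : Set.Ioo (0 : ℝ) 1) (k : ℕ) :
    ContinuousOn (Set.indicator {(q : ℝ) ^ (2 * k)} (1 : ℝ → ℝ)) (spectrum ℝ (elA q)) := by
  refine continuousOn_spectrum_elA q ?_
  refine (continuousWithinAt_const (b := (0 : ℝ))).congr_of_eventuallyEq ?_ ?_
  · filter_upwards [eventually_ne_even_pow q k] with x hx
    exact Set.indicator_of_notMem (s := {(q : ℝ) ^ (2 * k)}) (a := x) hx _
  · exact Set.indicator_of_notMem (s := {(q : ℝ) ^ (2 * k)}) (a := (0 : ℝ))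
      (pow_pos q.2.1 (2 * k)).ne _

lemma continuousOn_indicator_Icc (q : Set.Ioo (0 : ℝ) 1) (k : ℕ) :
    ContinuousOn (Set.indicator (Set.Icc 0 ((q : ℝ) ^ (2 * k))) (1 : ℝ → ℝ))
      (spectrum ℝ (elA q)) := by
  refine continuousOn_spectrum_elA q ?_
  have hp := pow_pos q.2.1 (2 * k)
  refine (continuousWithinAt_const (b := (1 : ℝ))).congr_of_eventuallyEq ?_ ?_
  · filter_upwards [self_mem_nhdsWithin, mem_nhdsWithin_of_mem_nhds (Iic_mem_nhds hp)]
      with x hx hx2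
    exact Set.indicator_of_mem (show x ∈ Set.Icc 0 ((q : ℝ) ^ (2 * k)) from ⟨hx, hx2⟩) _
  · exact Set.indicator_of_mem
      (show (0 : ℝ) ∈ Set.Icc 0 ((q : ℝ) ^ (2 * k)) from ⟨le_rfl, hp.le⟩) _

lemma star_chiPt (q : Set.Ioo (0 : ℝ) 1) (k : ℕ) : star (chiPt q k) = chiPt q k :=
  cfc_predicate (p := IsSelfAdjoint) _ (elA q)

lemma chiPt_mul_self (q : Set.Ioo (0 : ℝ) 1) (k : ℕ) : chiPt q k * chiPt q k = chiPt q k := by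
  have hc := continuousOn_indicator_singleton q k
  rw [chiPt, ← cfc_mul _ _ (elA q) hc hc]
  congr 1
  ext x
  by_cases hx : x ∈ ({(q : ℝ) ^ (2 * k)} : Set ℝ) <;> simp [hx]

lemma elA_mul_chiPt (q : Set.Ioo (0 : ℝ) 1) (k : ℕ) :
    elA q * chiPt q k = (((q : ℝ) ^ (2 * k) : ℝ) : ℂ) • chiPt q k := by
  have hc := continuousOn_indicator_singleton q k
  nth_rewrite 1 [← cfc_id' ℝ (elA q) (isSelfAdjoint_elA q)]
  rw [Complex.coe_smul, chiPt, ← cfc_mul _ _ (elA q) (continuousOn_id' _) hc,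
    ← cfc_smul _ _ (elA q) hc]
  congr 1
  ext x
  by_cases hx : x ∈ ({(q : ℝ) ^ (2 * k)} : Set ℝ)
  · rw [Set.mem_singleton_iff.mp hx]
    simp
  · simp [hx]

lemma chiPt_mul_elA (q : Set.Ioo (0 : ℝ) 1) (k : ℕ) :
    chiPt q k * elA q = (((q : ℝ) ^ (2 * k) : ℝ) : ℂ) • chiPt q k := by
  have h := congrArg star (elA_mul_chiPt q k)
  rwa [star_mul, star_smul, star_chiPt, (isSelfAdjoint_elA q).star_eq, Complex.star_def,
    Complex.conj_ofReal] at h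

/-- Evaluate χ_k A z in two ways: by the eigenvalue of z and by that of χ_k. -/
lemma chiPt_mul_eq_zero (q : Set.Ioo (0 : ℝ) 1) {k : ℕ} {z : Sphere q} {μ : ℂ}
    (hμ : μ ≠ (((q : ℝ) ^ (2 * k) : ℝ) : ℂ)) (hz : elA q * z = μ • z) : chiPt q k * z = 0 := by
  have h : μ • (chiPt q k * z) = (((q : ℝ) ^ (2 * k) : ℝ) : ℂ) • (chiPt q k * z) := by
    rw [← mul_smul_comm, ← hz, ← mul_assoc, chiPt_mul_elA, smul_mul_assoc]
  rw [← sub_eq_zero, ← sub_smul] at h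
  exact (smul_eq_zero.mp h).resolve_left (sub_ne_zero.mpr hμ)

lemma chiPt_mul_chiPt_of_ne (q : Set.Ioo (0 : ℝ) 1) {j k : ℕ} (h : j ≠ k) :
    chiPt q j * chiPt q k = 0 :=
  chiPt_mul_eq_zero q (fun h' => h (even_pow_injective q (by exact_mod_cast h'.symm)))
    (elA_mul_chiPt q k)

lemma chiPt_mul_chiIcc_of_lt (q : Set.Ioo (0 : ℝ) 1) {m k : ℕ} (h : m < k) :
    chiPt q m * chiIcc q k = 0 := by
  rw [chiPt, chiIcc, ← cfc_mul _ _ (elA q) (continuousOn_indicator_singleton q m)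
    (continuousOn_indicator_Icc q k), ← cfc_zero ℝ (elA q)]
  congr 1
  ext x
  by_cases hx : x ∈ ({(q : ℝ) ^ (2 * m)} : Set ℝ)
  · have h1 : x ∉ Set.Icc 0 ((q : ℝ) ^ (2 * k)) := by
      rw [Set.mem_singleton_iff.mp hx]
      intro h2
      have := (pow_le_pow_iff_right_of_lt_one₀ q.2.1 q.2.2).mp h2.2
      omega
    simp [h1]
  · simp [hx]

/-- The sum is one functional calculus of A, by a function that at each point has at most one
nonzero summand. Its supremum is therefore bounded by M whatever the size of `s`. -/
lemma norm_sum_smul_chiPt_le (q : Set.Ioo (0 : ℝ) 1) (s : Finset ℕ) {c : ℕ → ℝ} {M : ℝ}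
    (hM : 0 ≤ M) (hc : ∀ n, |c n| ≤ M) : ‖∑ n ∈ s, (c n : ℂ) • chiPt q n‖ ≤ M := by
  have h : ∑ n ∈ s, (c n : ℂ) • chiPt q n =
      cfc (∑ n ∈ s, c n • Set.indicator {(q : ℝ) ^ (2 * n)} (1 : ℝ → ℝ)) (elA q) := by
    rw [cfc_sum _ _ _ (fun n _ => (continuousOn_indicator_singleton q n).const_smul (c n))]
    refine Finset.sum_congr rfl fun n _ => ?_
    rw [Complex.coe_smul, chiPt]
    exact (cfc_smul (c n) _ (elA q) (continuousOn_indicator_singleton q n)).symm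
  rw [h]
  refine norm_cfc_le hM fun x hx => ?_
  rw [Finset.sum_apply]
  by_cases hx' : ∃ k ∈ s, x = (q : ℝ) ^ (2 * k)
  · obtain ⟨k, hk, rfl⟩ := hx'
    rw [Finset.sum_eq_single_of_mem k hk]
    · simpa using hc k
    · intro n _ hn
      have : (q : ℝ) ^ (2 * k) ∉ ({(q : ℝ) ^ (2 * n)} : Set ℝ) :=
        fun h => hn (even_pow_injective q h).symm
      rw [Pi.smul_apply, Set.indicator_of_notMem this, smul_zero]
  · rw [Finset.sum_eq_zero]
    · simpa using hM
    · intro n hn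
      have : x ∉ ({(q : ℝ) ^ (2 * n)} : Set ℝ) := fun h => hx' ⟨n, hn, h⟩
      rw [Pi.smul_apply, Set.indicator_of_notMem this, smul_zero]

lemma norm_chiPt_le (q : Set.Ioo (0 : ℝ) 1) (k : ℕ) : ‖chiPt q k‖ ≤ 1 := by
  simpa using norm_sum_smul_chiPt_le q {k} zero_le_one (c := fun _ => 1) (by simp)

lemma norm_chiIcc_le (q : Set.Ioo (0 : ℝ) 1) (k : ℕ) : ‖chiIcc q k‖ ≤ 1 := by
  refine norm_cfc_le zero_le_one fun x _ => ?_
  by_cases hx : x ∈ Set.Icc 0 ((q : ℝ) ^ (2 * k)) <;> simp [hx]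

/-! ### The relations of the Podles sphere -/

lemma bstar_b_mul_a (q : ℝ) : star (genb q) * genb q * gena q =
    ((q : ℂ) ^ 2) • (gena q * (star (genb q) * genb q)) := by
  have h := isSUqPair_gen q
  rw [mul_assoc, h.rel_ba, mul_smul_comm, ← mul_assoc, h.rel_bstar_a, smul_mul_assoc, smul_smul,
    ← sq, mul_assoc]

lemma elA_mul_elB (q : Set.Ioo (0 : ℝ) 1) :
    elA q * elB q = (((q : ℝ) : ℂ) ^ 2) • (elB q * elA q) := by
  apply Subtype.ext
  change star (genb (q : ℝ)) * genb q * (gena q * star (genb q)) =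
    (((q : ℝ) : ℂ) ^ 2) • (gena q * star (genb q) * (star (genb q) * genb q))
  rw [← mul_assoc, bstar_b_mul_a, smul_mul_assoc]
  simp only [mul_assoc]
  rw [(isSUqPair_gen (q : ℝ)).normal_b]

lemma star_elB_mul_elB (q : Set.Ioo (0 : ℝ) 1) :
    star (elB q) * elB q = elA q - (((q : ℝ) : ℂ) ^ 2) • (elA q * elA q) := by
  apply Subtype.ext
  change star (gena (q : ℝ) * star (genb q)) * (gena q * star (genb q)) =
    star (genb (q : ℝ)) * genb q -
      (((q : ℝ) : ℂ) ^ 2) • (star (genb (q : ℝ)) * genb q * (star (genb (q : ℝ)) * genb q))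
  have h : star (gena (q : ℝ) * star (genb q)) * (gena q * star (genb q)) =
      genb q * (star (gena (q : ℝ)) * gena q) * star (genb q) := by
    rw [star_mul, star_star]
    simp only [mul_assoc]
  rw [h, star_a_mul_a, mul_sub, mul_one, sub_mul, mul_smul_comm, smul_mul_assoc, ← mul_assoc,
    (isSUqPair_gen (q : ℝ)).normal_b, mul_assoc (star (genb (q : ℝ)) * genb q),
    (isSUqPair_gen (q : ℝ)).normal_b]

lemma smul_elB_mul_star_elB (q : Set.Ioo (0 : ℝ) 1) :
    (((q : ℝ) : ℂ) ^ 2) • (elB q * star (elB q)) = elA q - elA q * elA q := by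
  apply Subtype.ext
  change (((q : ℝ) : ℂ) ^ 2) • (gena (q : ℝ) * star (genb q) * star (gena q * star (genb q))) =
    star (genb (q : ℝ)) * genb q - star (genb (q : ℝ)) * genb q * (star (genb (q : ℝ)) * genb q)
  have h : gena (q : ℝ) * star (genb q) * star (gena q * star (genb q)) =
      gena q * (star (genb (q : ℝ)) * genb q) * star (gena q) := by
    rw [star_mul, star_star]
    simp only [mul_assoc]
  rw [h, ← smul_mul_assoc, ← bstar_b_mul_a, mul_assoc, a_mul_star_a, mul_sub, mul_one]

lemma star_elB_mul_elA (q : Set.Ioo (0 : ℝ) 1) :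
    star (elB q) * elA q = (((q : ℝ) : ℂ) ^ 2) • (elA q * star (elB q)) := by
  have h := congrArg star (elA_mul_elB q)
  rwa [star_mul, star_smul, star_mul, (isSelfAdjoint_elA q).star_eq, Complex.star_def, map_pow,
    Complex.conj_ofReal] at h

lemma elA_mul_star_elB (q : Set.Ioo (0 : ℝ) 1) :
    elA q * star (elB q) = ((((q : ℝ) : ℂ) ^ 2)⁻¹) • (star (elB q) * elA q) := by
  rw [star_elB_mul_elA, inv_smul_smul₀]
  exact pow_ne_zero _ (by exact_mod_cast q.2.1.ne')

/-- By A B = q² B A, each factor B multiplies the eigenvalue by q². -/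
lemma elA_mul_elB_pow_mul {q : Set.Ioo (0 : ℝ) 1} {z : Sphere q} {μ : ℂ}
    (hz : elA q * z = μ • z) (j : ℕ) :
    elA q * (elB q ^ j * z) = ((((q : ℝ) : ℂ) ^ 2) ^ j * μ) • (elB q ^ j * z) := by
  induction j with
  | zero => simpa using hz
  | succ j ih =>
    rw [pow_succ' (elB q), mul_assoc, ← mul_assoc, elA_mul_elB, smul_mul_assoc, mul_assoc, ih,
      mul_smul_comm, smul_smul, ← mul_assoc, ← pow_succ']

lemma elA_mul_star_elB_pow_mul {q : Set.Ioo (0 : ℝ) 1} {z : Sphere q} {μ : ℂ}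
    (hz : elA q * z = μ • z) (j : ℕ) :
    elA q * (star (elB q) ^ j * z) =
      (((((q : ℝ) : ℂ) ^ 2)⁻¹) ^ j * μ) • (star (elB q) ^ j * z) := by
  induction j with
  | zero => simpa using hz
  | succ j ih =>
    rw [pow_succ' (star (elB q)), mul_assoc, ← mul_assoc, elA_mul_star_elB, smul_mul_assoc,
      mul_assoc, ih, mul_smul_comm, smul_smul, ← mul_assoc, ← pow_succ']

lemma star_elB_mul_elB_mul {q : Set.Ioo (0 : ℝ) 1} {z : Sphere q} {μ : ℂ}
    (hz : elA q * z = μ • z) :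
    star (elB q) * (elB q * z) = (μ * (1 - ((q : ℝ) : ℂ) ^ 2 * μ)) • z := by
  rw [← mul_assoc, star_elB_mul_elB, sub_mul, smul_mul_assoc, mul_assoc, hz, mul_smul_comm, hz,
    smul_smul, smul_smul, ← sub_smul]
  congr 1
  ring

lemma elB_mul_star_elB_mul {q : Set.Ioo (0 : ℝ) 1} {z : Sphere q} {μ : ℂ}
    (hz : elA q * z = μ • z) :
    elB q * (star (elB q) * z) = ((((q : ℝ) : ℂ) ^ 2)⁻¹ * (μ * (1 - μ))) • z := by
  have h0 : ((q : ℝ) : ℂ) ^ 2 ≠ 0 := pow_ne_zero _ (by exact_mod_cast q.2.1.ne')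
  rw [mul_smul, eq_inv_smul_iff₀ h0, ← mul_assoc, ← smul_mul_assoc, smul_elB_mul_star_elB, sub_mul,
    mul_assoc, hz, mul_smul_comm, hz, smul_smul, ← sub_smul]
  congr 1
  ring

/-! ### Minimality of the spectral projections -/

/-- The span of the vectors `B^j χ_k` and `(B*)^j χ_k`. -/
def fibreSpan (q : Set.Ioo (0 : ℝ) 1) (k : ℕ) : Submodule ℂ (Sphere q) :=
  Submodule.span ℂ (Set.range (fun j : ℕ => elB q ^ j * chiPt q k) ∪
    Set.range (fun j : ℕ => star (elB q) ^ j * chiPt q k))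

lemma elB_pow_mul_mem_fibreSpan (q : Set.Ioo (0 : ℝ) 1) (k j : ℕ) :
    elB q ^ j * chiPt q k ∈ fibreSpan q k :=
  Submodule.subset_span (Or.inl ⟨j, rfl⟩)

lemma star_elB_pow_mul_mem_fibreSpan (q : Set.Ioo (0 : ℝ) 1) (k j : ℕ) :
    star (elB q) ^ j * chiPt q k ∈ fibreSpan q k :=
  Submodule.subset_span (Or.inr ⟨j, rfl⟩)

lemma mul_mem_fibreSpan_of_generators {q : Set.Ioo (0 : ℝ) 1} {k : ℕ} {x : Sphere q}
    (h1 : ∀ j : ℕ, x * (elB q ^ j * chiPt q k) ∈ fibreSpan q k)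
    (h2 : ∀ j : ℕ, x * (star (elB q) ^ j * chiPt q k) ∈ fibreSpan q k)
    {z : Sphere q} (hz : z ∈ fibreSpan q k) : x * z ∈ fibreSpan q k := by
  induction hz using Submodule.span_induction with
  | mem z hz =>
    rcases hz with ⟨j, rfl⟩ | ⟨j, rfl⟩
    · exact h1 j
    · exact h2 j
  | zero => simp
  | add y z _ _ hy hz => rw [mul_add]; exact add_mem hy hz
  | smul c z _ hz => rw [mul_smul_comm]; exact Submodule.smul_mem _ _ hz

lemma elA_mul_mem_fibreSpan {q : Set.Ioo (0 : ℝ) 1} {k : ℕ} {z : Sphere q}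
    (hz : z ∈ fibreSpan q k) : elA q * z ∈ fibreSpan q k := by
  refine mul_mem_fibreSpan_of_generators (fun j => ?_) (fun j => ?_) hz
  · rw [elA_mul_elB_pow_mul (elA_mul_chiPt q k)]
    exact Submodule.smul_mem _ _ (elB_pow_mul_mem_fibreSpan q k j)
  · rw [elA_mul_star_elB_pow_mul (elA_mul_chiPt q k)]
    exact Submodule.smul_mem _ _ (star_elB_pow_mul_mem_fibreSpan q k j)

/-- Only B (B*)^{j+1} χ_k needs an argument: B B* is a polynomial in A, hence a scalar on the
eigenvector (B*)^j χ_k. -/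
lemma elB_mul_mem_fibreSpan {q : Set.Ioo (0 : ℝ) 1} {k : ℕ} {z : Sphere q}
    (hz : z ∈ fibreSpan q k) : elB q * z ∈ fibreSpan q k := by
  refine mul_mem_fibreSpan_of_generators (fun j => ?_) (fun j => ?_) hz
  · rw [← mul_assoc, ← pow_succ']
    exact elB_pow_mul_mem_fibreSpan q k (j + 1)
  · rcases j with _ | j
    · simpa using elB_pow_mul_mem_fibreSpan q k 1
    · rw [pow_succ', mul_assoc,
        elB_mul_star_elB_mul (elA_mul_star_elB_pow_mul (elA_mul_chiPt q k) j)]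
      exact Submodule.smul_mem _ _ (star_elB_pow_mul_mem_fibreSpan q k j)

lemma star_elB_mul_mem_fibreSpan {q : Set.Ioo (0 : ℝ) 1} {k : ℕ} {z : Sphere q}
    (hz : z ∈ fibreSpan q k) : star (elB q) * z ∈ fibreSpan q k := by
  refine mul_mem_fibreSpan_of_generators (fun j => ?_) (fun j => ?_) hz
  · rcases j with _ | j
    · simpa using star_elB_pow_mul_mem_fibreSpan q k 1
    · rw [pow_succ', mul_assoc,
        star_elB_mul_elB_mul (elA_mul_elB_pow_mul (elA_mul_chiPt q k) j)]
      exact Submodule.smul_mem _ _ (elB_pow_mul_mem_fibreSpan q k j)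
  · rw [← mul_assoc, ← pow_succ']
    exact star_elB_pow_mul_mem_fibreSpan q k (j + 1)

/-- For j ≥ 1 the spanning vectors satisfy the eigenvalue equation of A with q^{2(k+j)} or
q^{2(k-j)}, both different from q^{2k}, so χ_k annihilates them. Only j = 0 survives. -/
lemma chiPt_mul_mem_span {q : Set.Ioo (0 : ℝ) 1} {k : ℕ} {z : Sphere q}
    (hz : z ∈ fibreSpan q k) : chiPt q k * z ∈ ℂ ∙ chiPt q k := by
  have hq : (q : ℝ) ^ 2 ≠ 0 := pow_ne_zero _ q.2.1.ne'
  have hk : (q : ℝ) ^ (2 * k) ≠ 0 := pow_ne_zero _ q.2.1.ne'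
  have hlt : (q : ℝ) ^ 2 < 1 := pow_lt_one₀ q.2.1.le q.2.2 two_ne_zero
  have hpow : ∀ j : ℕ, ((q : ℝ) ^ 2) ^ (j + 1) ≠ 1 := fun j =>
    (pow_lt_one₀ (pow_nonneg q.2.1.le 2) hlt j.succ_ne_zero).ne
  induction hz using Submodule.span_induction with
  | mem z hz =>
    rcases hz with ⟨j, rfl⟩ | ⟨j, rfl⟩ <;> rcases j with _ | j
    · simp [chiPt_mul_self]
    · rw [chiPt_mul_eq_zero q ?_ (elA_mul_elB_pow_mul (elA_mul_chiPt q k) (j + 1))]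
      · exact zero_mem _
      · norm_cast
        intro h
        exact hpow j (mul_right_cancel₀ hk (h.trans (one_mul _).symm))
    · simp [chiPt_mul_self]
    · rw [chiPt_mul_eq_zero q ?_ (elA_mul_star_elB_pow_mul (elA_mul_chiPt q k) (j + 1))]
      · exact zero_mem _
      · norm_cast
        intro h
        have h1 := mul_right_cancel₀ hk (h.trans (one_mul _).symm)
        rw [inv_pow, inv_eq_one] at h1
        exact hpow j h1
  | zero => simp
  | add y z _ _ hy hz => rw [mul_add]; exact add_mem hy hz
  | smul c z _ hz => rw [mul_smul_comm]; exact Submodule.smul_mem _ _ hz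

/-- The `*`-subalgebra generated by `A` and `B`. -/
def coordSphere (q : Set.Ioo (0 : ℝ) 1) : StarSubalgebra ℂ (SU q) :=
  StarAlgebra.adjoin ℂ {star (genb q) * genb q, gena q * star (genb q)}

lemma mul_mem_fibreSpan_of_mem_coord {q : Set.Ioo (0 : ℝ) 1} {x : SU q}
    (hx : x ∈ coordSphere q) (k : ℕ) :
    ∃ hS : x ∈ Sphere q, ∀ z ∈ fibreSpan q k, (⟨x, hS⟩ : Sphere q) * z ∈ fibreSpan q k := by
  -- The star subalgebra unfolds to the algebra generated by A, B and their adjoints, so the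
  -- induction has no star case.
  change x ∈ Algebra.adjoin ℂ _ at hx
  induction hx using Algebra.adjoin_induction with
  | mem x hx =>
    rcases hx with (rfl | rfl) | (hx | hx)
    · exact ⟨(elA q).2, fun z => elA_mul_mem_fibreSpan⟩
    · exact ⟨(elB q).2, fun z => elB_mul_mem_fibreSpan⟩
    · obtain rfl : x = (star (elA q) : Sphere q) := by
        rw [StarMemClass.coe_star, coe_elA, ← hx, star_star]
      refine ⟨(star (elA q)).2, fun z => ?_⟩
      rw [Subtype.coe_eta, (isSelfAdjoint_elA q).star_eq]
      exact elA_mul_mem_fibreSpan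
    · obtain rfl : x = (star (elB q) : Sphere q) := by
        rw [StarMemClass.coe_star]
        exact (star_star x).symm.trans (congrArg star hx)
      exact ⟨(star (elB q)).2, fun z => star_elB_mul_mem_fibreSpan⟩
  | algebraMap c =>
    refine ⟨algebraMap_mem _ c, fun z hz => ?_⟩
    have : (⟨algebraMap ℂ (SU q) c, algebraMap_mem _ c⟩ : Sphere q) = algebraMap ℂ _ c := rfl
    rw [this, ← Algebra.smul_def]
    exact Submodule.smul_mem _ _ hz
  | add x y _ _ hx hy =>
    obtain ⟨hx, hx'⟩ := hx
    obtain ⟨hy, hy'⟩ := hy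
    refine ⟨add_mem hx hy, fun z hz => ?_⟩
    have := add_mem (hx' z hz) (hy' z hz)
    rwa [← add_mul] at this
  | mul x y _ _ hx hy =>
    obtain ⟨hx, hx'⟩ := hx
    obtain ⟨hy, hy'⟩ := hy
    refine ⟨mul_mem hx hy, fun z hz => ?_⟩
    have := hx' _ (hy' z hz)
    rwa [← mul_assoc] at this

/-- The spectral projections `χ_k` are minimal. -/
lemma chiPt_mul_mul_chiPt_mem_span (q : Set.Ioo (0 : ℝ) 1) (k : ℕ) (x : Sphere q) :
    chiPt q k * x * chiPt q k ∈ ℂ ∙ chiPt q k := by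
  -- The line spanned by χ_k is finite-dimensional, hence closed, so the claim passes from the dense
  -- coordinate algebra to all of `Sphere q`.
  have hcl : IsClosed {y : Sphere q | chiPt q k * y * chiPt q k ∈ ℂ ∙ chiPt q k} :=
    (Submodule.closed_of_finiteDimensional (ℂ ∙ chiPt q k)).preimage (by fun_prop)
  have hmem : x ∈ closure {y : Sphere q | (y : SU q) ∈ coordSphere q} := by
    rw [closure_subtype]
    refine closure_mono ?_ x.2
    intro y hy
    exact ⟨⟨y, StarSubalgebra.le_topologicalClosure _ hy⟩, hy, rfl⟩
  refine closure_minimal ?_ hcl hmem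
  intro y hy
  obtain ⟨hS, h⟩ := mul_mem_fibreSpan_of_mem_coord hy k
  have h1 : chiPt q k ∈ fibreSpan q k := by simpa using elB_pow_mul_mem_fibreSpan q k 0
  have h2 := chiPt_mul_mem_span (h _ h1)
  rwa [← mul_assoc] at h2

/-! ### Sums of matrix units -/

lemma normC_succ_left (q : Set.Ioo (0 : ℝ) 1) (n : ℕ) :
    normC q (n + 1) n = (q : ℝ) ^ (2 * n) * (1 - (q : ℝ) ^ (2 * (n + 1))) := by
  simp [normC]

lemma normC_succ_right (q : Set.Ioo (0 : ℝ) 1) (n : ℕ) :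
    normC q n (n + 1) = (q : ℝ) ^ (2 * n) * (1 - (q : ℝ) ^ (2 * (n + 1))) := by
  simp [normC]

lemma normC_succ_pos (q : Set.Ioo (0 : ℝ) 1) (n : ℕ) :
    0 < (q : ℝ) ^ (2 * n) * (1 - (q : ℝ) ^ (2 * (n + 1))) :=
  mul_pos (pow_pos q.2.1 _) (sub_pos.mpr (pow_lt_one₀ q.2.1.le q.2.2 (by omega)))

lemma matUnit_self (q : Set.Ioo (0 : ℝ) 1) (n : ℕ) : matUnit q n n = chiPt q n := by
  simp [matUnit, normC]

lemma matUnit_succ_left (q : Set.Ioo (0 : ℝ) 1) (n : ℕ) : matUnit q (n + 1) n =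
    (((√((q : ℝ) ^ (2 * n) * (1 - (q : ℝ) ^ (2 * (n + 1)))))⁻¹ : ℝ) : ℂ) •
      (elB q * chiPt q n) := by
  simp [matUnit, normC_succ_left]

lemma matUnit_succ_right (q : Set.Ioo (0 : ℝ) 1) (n : ℕ) : matUnit q n (n + 1) =
    (((√((q : ℝ) ^ (2 * n) * (1 - (q : ℝ) ^ (2 * (n + 1)))))⁻¹ : ℝ) : ℂ) •
      (star (elB q) * chiPt q (n + 1)) := by
  simp [matUnit, normC_succ_right]

lemma matUnit_mul_chiPt (q : Set.Ioo (0 : ℝ) 1) (n k : ℕ) :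
    matUnit q n k * chiPt q k = matUnit q n k := by
  rw [matUnit, smul_mul_assoc]
  split_ifs <;> rw [mul_assoc, chiPt_mul_self]

lemma inv_sqrt_mul_inv_sqrt_mul {c : ℝ} (hc : 0 < c) :
    (((√c)⁻¹ : ℝ) : ℂ) * (((√c)⁻¹ : ℝ) : ℂ) * (c : ℂ) = 1 := by
  rw [← Complex.ofReal_mul, ← Complex.ofReal_mul, ← mul_inv, Real.mul_self_sqrt hc.le,
    inv_mul_cancel₀ hc.ne', Complex.ofReal_one]

/-- B*B acts on χ_n as the scalar q^{2n} (1 - q^{2(n+1)}), exactly what the normalizing constants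
cancel; off the diagonal χ_m χ_n = 0. -/
lemma star_matUnit_succ_left_mul (q : Set.Ioo (0 : ℝ) 1) (m n : ℕ) :
    star (matUnit q (m + 1) m) * matUnit q (n + 1) n = if m = n then chiPt q n else 0 := by
  have h : star (elB q * chiPt q m) * (elB q * chiPt q n) =
      (((q : ℝ) ^ (2 * n) * (1 - (q : ℝ) ^ (2 * (n + 1))) : ℝ) : ℂ) •
        (chiPt q m * chiPt q n) := by
    rw [star_mul, star_chiPt, mul_assoc, star_elB_mul_elB_mul (elA_mul_chiPt q n), mul_smul_comm]
    congr 1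
    push_cast
    ring
  rw [matUnit_succ_left, matUnit_succ_left, star_smul, smul_mul_smul_comm, h, Complex.star_def,
    Complex.conj_ofReal, smul_smul]
  split_ifs with hmn
  · rw [hmn, chiPt_mul_self, inv_sqrt_mul_inv_sqrt_mul (normC_succ_pos q n), one_smul]
  · rw [chiPt_mul_chiPt_of_ne q hmn, smul_zero]

lemma star_matUnit_succ_right_mul (q : Set.Ioo (0 : ℝ) 1) (m n : ℕ) :
    star (matUnit q m (m + 1)) * matUnit q n (n + 1) =
      if m = n then chiPt q (n + 1) else 0 := by
  have h : star (star (elB q) * chiPt q (m + 1)) * (star (elB q) * chiPt q (n + 1)) =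
      (((q : ℝ) ^ (2 * n) * (1 - (q : ℝ) ^ (2 * (n + 1))) : ℝ) : ℂ) •
        (chiPt q (m + 1) * chiPt q (n + 1)) := by
    have h0 : ((q : ℝ) : ℂ) ≠ 0 := by exact_mod_cast q.2.1.ne'
    rw [star_mul, star_chiPt, star_star, mul_assoc, elB_mul_star_elB_mul (elA_mul_chiPt q (n + 1)),
      mul_smul_comm]
    congr 1
    push_cast
    field_simp
    ring
  rw [matUnit_succ_right, matUnit_succ_right, star_smul, smul_mul_smul_comm, h, Complex.star_def,
    Complex.conj_ofReal, smul_smul]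
  split_ifs with hmn
  · rw [hmn, chiPt_mul_self, inv_sqrt_mul_inv_sqrt_mul (normC_succ_pos q n), one_smul]
  · rw [chiPt_mul_chiPt_of_ne q (by omega), smul_zero]

lemma norm_le_one_of_star_mul_self {q : Set.Ioo (0 : ℝ) 1} {x : Sphere q}
    (h : ‖star x * x‖ ≤ 1) : ‖x‖ ≤ 1 := by
  have h1 : ‖star x * x‖ = ‖x‖ * ‖x‖ :=
    CStarRing.norm_star_mul_self (x := x)
  nlinarith [norm_nonneg x]

lemma norm_sum_chiPt_le (q : Set.Ioo (0 : ℝ) 1) (s : Finset ℕ) : ‖∑ n ∈ s, chiPt q n‖ ≤ 1 := by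
  simpa using norm_sum_smul_chiPt_le q s zero_le_one (c := fun _ => 1) (by simp)

/-- With T the sum, T*T is a sum of distinct χ_n, so the bound on T follows from the C*-identity. -/
lemma norm_sum_matUnit_succ_left_le (q : Set.Ioo (0 : ℝ) 1) (s : Finset ℕ) :
    ‖∑ n ∈ s, matUnit q (n + 1) n‖ ≤ 1 := by
  refine norm_le_one_of_star_mul_self ?_
  simp_rw [star_sum, Finset.sum_mul_sum, star_matUnit_succ_left_mul]
  simpa using norm_sum_chiPt_le q s

lemma norm_sum_matUnit_succ_right_le (q : Set.Ioo (0 : ℝ) 1) (s : Finset ℕ) :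
    ‖∑ n ∈ s, matUnit q n (n + 1)‖ ≤ 1 := by
  refine norm_le_one_of_star_mul_self ?_
  simp_rw [star_sum, Finset.sum_mul_sum, star_matUnit_succ_right_mul]
  -- The initial projections are now χ_{n+1}, whence the shifted index set.
  simpa using norm_sum_chiPt_le q (s.map (addRightEmbedding 1))

/-! ### Eigenvectors of `A` -/

/-- Take g(x) = (x - q^{2k})⁻¹, which Lean sets to 0 at x = q^{2k}; then χ_k + g (A - q^{2k}) = 1.
Applied to an eigenvector for q^{2k}, in the algebra or in a representation, this shows that χ_k
fixes it. -/
lemma exists_chiPt_add_mul_elA (q : Set.Ioo (0 : ℝ) 1) (k : ℕ) : ∃ g : Sphere q,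
    chiPt q k + g * elA q = 1 + (((q : ℝ) ^ (2 * k) : ℝ) : ℂ) • g := by
  have hc := continuousOn_indicator_singleton q k
  have hg : ContinuousOn (fun x : ℝ => (x - (q : ℝ) ^ (2 * k))⁻¹) (spectrum ℝ (elA q)) := by
    refine continuousOn_spectrum_elA q (ContinuousAt.continuousWithinAt ?_)
    refine (continuousAt_id.sub continuousAt_const).inv₀ ?_
    change (0 : ℝ) - (q : ℝ) ^ (2 * k) ≠ 0
    rw [zero_sub]
    exact neg_ne_zero.mpr (pow_pos q.2.1 _).ne'
  refine ⟨cfc (fun x : ℝ => (x - (q : ℝ) ^ (2 * k))⁻¹) (elA q), ?_⟩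
  have h1 : chiPt q k + cfc (fun x : ℝ => (x - (q : ℝ) ^ (2 * k))⁻¹) (elA q) * elA q =
      cfc (fun x : ℝ => Set.indicator {(q : ℝ) ^ (2 * k)} (1 : ℝ → ℝ) x +
        (x - (q : ℝ) ^ (2 * k))⁻¹ * x) (elA q) := by
    rw [cfc_add (elA q) _ (fun x : ℝ => (x - (q : ℝ) ^ (2 * k))⁻¹ * x) hc
      (hg.mul (continuousOn_id' _)),
      cfc_mul _ _ (elA q) hg (continuousOn_id' _), cfc_id' ℝ (elA q) (isSelfAdjoint_elA q)]
    rfl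
  have h2 : 1 + (((q : ℝ) ^ (2 * k) : ℝ) : ℂ) •
      cfc (fun x : ℝ => (x - (q : ℝ) ^ (2 * k))⁻¹) (elA q) =
      cfc (fun x : ℝ => (1 : ℝ) + (q : ℝ) ^ (2 * k) • (x - (q : ℝ) ^ (2 * k))⁻¹) (elA q) := by
    rw [cfc_add (elA q) _ (fun x : ℝ => (q : ℝ) ^ (2 * k) • (x - (q : ℝ) ^ (2 * k))⁻¹)
      continuousOn_const (hg.const_smul ((q : ℝ) ^ (2 * k))), cfc_smul _ _ (elA q) hg,
      cfc_const_one ℝ (elA q) (isSelfAdjoint_elA q), Complex.coe_smul]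
  rw [h1, h2]
  congr 1
  ext x
  by_cases hx : x = (q : ℝ) ^ (2 * k)
  · simp [hx]
  · have hx' : x ∉ ({(q : ℝ) ^ (2 * k)} : Set ℝ) := hx
    have hx2 : x - (q : ℝ) ^ (2 * k) ≠ 0 := sub_ne_zero.mpr hx
    rw [Set.indicator_of_notMem hx', smul_eq_mul]
    field_simp
    ring

lemma coe_elA_mul_coe_chiPt (q : Set.Ioo (0 : ℝ) 1) (k : ℕ) :
    star (genb (q : ℝ)) * genb q * (chiPt q k : SU q) =
      (((q : ℝ) ^ (2 * k) : ℝ) : ℂ) • (chiPt q k : SU q) :=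
  congrArg Subtype.val (elA_mul_chiPt q k)

lemma coe_chiPt_mul_of_eigen (q : Set.Ioo (0 : ℝ) 1) {k : ℕ} {x : SU q}
    (hx : star (genb (q : ℝ)) * genb q * x = (((q : ℝ) ^ (2 * k) : ℝ) : ℂ) • x) :
    (chiPt q k : SU q) * x = x := by
  obtain ⟨g, hg⟩ := exists_chiPt_add_mul_elA q k
  have h : (chiPt q k : SU q) + g * (star (genb (q : ℝ)) * genb q) =
      1 + (((q : ℝ) ^ (2 * k) : ℝ) : ℂ) • (g : SU q) := congrArg Subtype.val hg
  have h2 := congrArg (· * x) h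
  simp only [add_mul] at h2
  rw [mul_assoc (g : SU q), hx, mul_smul_comm, smul_mul_assoc, one_mul] at h2
  exact add_right_cancel h2

lemma star_coe_chiPt (q : Set.Ioo (0 : ℝ) 1) (k : ℕ) :
    star (chiPt q k : SU q) = chiPt q k :=
  congrArg Subtype.val (star_chiPt q k)

/-- Since b and b* commute with A, they preserve the eigenspace: χ_k b χ_k = b χ_k, and likewise for
b*. The adjoint of the second identity reads χ_k b χ_k = χ_k b. -/
lemma commute_chiPt_genb (q : Set.Ioo (0 : ℝ) 1) (k : ℕ) :
    Commute (chiPt q k : SU q) (genb q) := by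
  have hn := (isSUqPair_gen (q : ℝ)).normal_b
  have h1 : (chiPt q k : SU q) * (genb q * chiPt q k) = genb q * chiPt q k := by
    refine coe_chiPt_mul_of_eigen q ?_
    rw [← mul_smul_comm, ← coe_elA_mul_coe_chiPt, ← hn]
    simp only [mul_assoc]
    rw [← mul_assoc (star (genb (q : ℝ))), ← hn, mul_assoc]
  have h2 : (chiPt q k : SU q) * (star (genb q) * chiPt q k) = star (genb q) * chiPt q k := by
    refine coe_chiPt_mul_of_eigen q ?_
    rw [← mul_smul_comm, ← coe_elA_mul_coe_chiPt]
    simp only [mul_assoc]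
    rw [← mul_assoc (genb (q : ℝ)), hn, mul_assoc]
  have h3 := congrArg star h2
  rw [star_mul, star_mul, star_star, star_coe_chiPt, mul_assoc, h1] at h3
  exact h3.symm

lemma commute_chiPt_star_genb (q : Set.Ioo (0 : ℝ) 1) (k : ℕ) :
    Commute (chiPt q k : SU q) (star (genb q)) := by
  have h := (commute_chiPt_genb q k).star_star
  rwa [star_coe_chiPt] at h

/-! ### A test vector in `H_+` -/

lemma rho_elA_vec (q : Set.Ioo (0 : ℝ) 1) (k : ℕ) :
    rho q (star (genb (q : ℝ)) * genb q) (vec k) = (((q : ℝ) ^ (2 * k) : ℝ) : ℂ) • vec k := by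
  have hb : rho q (genb q) = opB q := rfl
  rw [map_mul, map_star, hb, star_opB]
  ext ⟨n, j⟩
  change (((q : ℝ) ^ n : ℝ) : ℂ) * ((((q : ℝ) ^ n : ℝ) : ℂ) * vec k (n, j + 1 - 1)) =
    (((q : ℝ) ^ (2 * k) : ℝ) : ℂ) * vec k (n, j)
  rw [add_sub_cancel_right]
  by_cases h : n = k
  · subst h
    push_cast
    ring
  · have : vec k (n, j) = 0 := by
      rw [vec, lp.single_apply_ne]
      simp [h]
    rw [this]
    simp

lemma rho_chiPt_vec (q : Set.Ioo (0 : ℝ) 1) (k : ℕ) :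
    rho q (chiPt q k : SU q) (vec k) = vec k := by
  obtain ⟨g, hg⟩ := exists_chiPt_add_mul_elA q k
  have h : (chiPt q k : SU q) + g * (star (genb (q : ℝ)) * genb q) =
      1 + (((q : ℝ) ^ (2 * k) : ℝ) : ℂ) • (g : SU q) := congrArg Subtype.val hg
  have h2 := congrArg (fun T => rho q T (vec k)) h
  simp only [map_add, map_mul (rho q) (g : SU q), map_one, map_smul, add_apply, smul_apply,
    mul_apply_eq_comp, rho_elA_vec, one_apply_eq_self] at h2
  exact add_right_cancel h2

lemma norm_toHh_sq (q : Set.Ioo (0 : ℝ) 1) (x : SU q) :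
    ((‖toHh q x‖ : ℝ) : ℂ) ^ 2 = haar q (star x * x) := by
  have h : ‖toHh q x‖ = ‖(haar q).toPreGNS x‖ := UniformSpace.Completion.norm_coe _
  rw [h]
  exact (haar q).preGNS_norm_sq _

/-- The Haar state of x*x is a sum of the ‖ρ(x) e_k‖² with strictly positive weights, so its
vanishing kills every term. -/
lemma rho_vec_eq_zero_of_toHh_eq_zero (q : Set.Ioo (0 : ℝ) 1) {x : SU q} (hx : toHh q x = 0)
    (k : ℕ) : rho q x (vec k) = 0 := by
  have hq : (q : ℝ) ^ 2 < 1 := pow_lt_one₀ q.2.1.le q.2.2 two_ne_zero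
  have h0 := norm_toHh_sq q x
  rw [hx, haar_apply] at h0
  have hterm : ∀ n : ℕ, ((q : ℝ) : ℂ) ^ (2 * n) * ⟪vec n, rho q (star x * x) (vec n)⟫_ℂ =
      (((q : ℝ) ^ (2 * n) * ‖rho q x (vec n)‖ ^ 2 : ℝ) : ℂ) := fun n => by
    rw [map_mul, map_star, mul_apply_eq_comp, ContinuousLinearMap.star_eq_adjoint,
      ContinuousLinearMap.adjoint_inner_right, inner_self_eq_norm_sq_to_K]
    push_cast
    rfl
  have hs := haar_summable q (star x * x)
  simp only [hterm] at h0 hs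
  rw [← Complex.ofReal_tsum] at h0
  rw [Complex.summable_ofReal] at hs
  norm_cast at h0
  rw [norm_zero, zero_pow two_ne_zero, eq_comm, mul_eq_zero] at h0
  have h1 := h0.resolve_left (by linarith)
  have h2 := hs.hasSum
  rw [h1, hasSum_zero_iff_of_nonneg fun n =>
    mul_nonneg (pow_nonneg q.2.1.le _) (sq_nonneg _)] at h2
  have h3 := congrFun h2 k
  simpa [q.2.1.ne'] using h3

/-- This is the vector of H_+ on which ξ is tested. Multiplying it by b* gives χ_k A, which acts on
e_k as q^{2k} ≠ 0. -/
lemma toHh_chiPt_mul_genb_ne_zero (q : Set.Ioo (0 : ℝ) 1) (k : ℕ) :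
    toHh q ((chiPt q k : SU q) * genb q) ≠ 0 := by
  intro h
  have h1 := rho_vec_eq_zero_of_toHh_eq_zero q h k
  have h2 : rho q (star (genb (q : ℝ)) * ((chiPt q k : SU q) * genb q)) (vec k) = 0 := by
    rw [map_mul, mul_apply_eq_comp, h1, map_zero]
  rw [← mul_assoc, ← (commute_chiPt_star_genb q k).eq, mul_assoc, map_mul, mul_apply_eq_comp,
    rho_elA_vec, map_smul, rho_chiPt_vec] at h2
  have h3 := (smul_eq_zero.mp h2).resolve_left
    (by exact_mod_cast (pow_pos q.2.1 (2 * k)).ne')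
  have h4 := norm_vec k
  rw [h3, norm_zero] at h4
  exact zero_ne_one h4

/-! ### The norm of the integrand -/

lemma mul_chiPt_of_mem_fibre {q : Set.Ioo (0 : ℝ) 1} {k : ℕ} {y : Sphere q}
    (hy : y ∈ fibre q k) : y * chiPt q k = y := by
  obtain ⟨x, rfl⟩ := hy
  rw [LinearMap.mulRight_apply, mul_assoc, chiPt_mul_self]

lemma exists_star_mul_self_eq_smul_chiPt {q : Set.Ioo (0 : ℝ) 1} {k : ℕ} {y : Sphere q}
    (hy : y ∈ fibre q k) : ∃ c : ℂ, star y * y = c • chiPt q k := by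
  obtain ⟨c, hc⟩ := Submodule.mem_span_singleton.mp (chiPt_mul_mul_chiPt_mem_span q k (star y * y))
  refine ⟨c, ?_⟩
  have h := congrArg star (mul_chiPt_of_mem_fibre hy)
  rw [star_mul, star_chiPt] at h
  rw [hc, ← mul_assoc, h, mul_assoc, mul_chiPt_of_mem_fibre hy]

/-- For T = y (b*)² one has T*T = c χ_k A², where y*y = c χ_k. On x = χ_k b this gives ‖T x‖² = |c|
q^{4k} ‖x‖² ≥ q^{4k} ‖y‖² ‖x‖², and T x = ξ x because χ_k x = x. -/
lemma norm_fibrePart_le {q : Set.Ioo (0 : ℝ) 1} {ξ : Hplus q →L[ℂ] Hminus q} {k : ℕ}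
    {y : Sphere q} (h : IsFibrePart ξ k y) : (q : ℝ) ^ (2 * k) * ‖y‖ ≤ ‖ξ‖ := by
  obtain ⟨x, hx⟩ : ∃ x : SU q, x = (chiPt q k : SU q) * genb q := ⟨_, rfl⟩
  have hx0 : toHh q x ≠ 0 := hx ▸ toHh_chiPt_mul_genb_ne_zero q k
  have hp := pow_pos q.2.1 (2 * k)
  have hchi : (chiPt q k : SU q) * chiPt q k = chiPt q k :=
    congrArg Subtype.val (chiPt_mul_self q k)
  have hchix : (chiPt q k : SU q) * x = x := by
    rw [hx, ← mul_assoc, hchi]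
  have hxm : toHh q x ∈ Hn q 1 := by
    rw [hx, ← leftMul_toHh]
    exact leftMul_mem_Hn (chiPt q k) (Submodule.le_topologicalClosure _
      (Submodule.mem_map_of_mem (genb_mem_homog q)))
  have hpos : 0 < ‖toHh q x‖ := norm_pos_iff.mpr hx0
  obtain ⟨c, hc⟩ := exists_star_mul_self_eq_smul_chiPt h.1
  have hyc : ‖y‖ ^ 2 ≤ ‖c‖ := by
    have h1 : ‖star y * y‖ = ‖y‖ * ‖y‖ := CStarRing.norm_star_mul_self (x := y)
    rw [sq, ← h1, hc, norm_smul]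
    exact mul_le_of_le_one_right (norm_nonneg _) (norm_chiPt_le q k)
  have hstable : sphereMul q 1 (chiPt q k) ⟨toHh q x, hxm⟩ = ⟨toHh q x, hxm⟩ := by
    apply Subtype.ext
    change leftMul q (chiPt q k : SU q) (toHh q x) = toHh q x
    rw [leftMul_toHh, hchix]
  have hξ := h.2 ⟨toHh q x, hxm⟩
  rw [hstable] at hξ
  have hle : ‖leftMul q ((y : SU q) * star (genb q) ^ 2) (toHh q x)‖ ≤ ‖ξ‖ * ‖toHh q x‖ := by
    rw [← hξ]
    exact ξ.le_opNorm ⟨toHh q x, hxm⟩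
  have hycoe : star (y : SU q) * y = c • (chiPt q k : SU q) := congrArg Subtype.val hc
  have hcomm := (commute_chiPt_genb q k).pow_right 2
  have hn : Commute (genb (q : ℝ)) (star (genb q)) := (isSUqPair_gen (q : ℝ)).normal_b
  have hAx : star (genb (q : ℝ)) * genb q * x = (((q : ℝ) ^ (2 * k) : ℝ) : ℂ) • x := by
    rw [hx, ← mul_assoc, coe_elA_mul_coe_chiPt, smul_mul_assoc]
  have hprod : star ((y : SU q) * star (genb q) ^ 2) * ((y : SU q) * star (genb q) ^ 2) * x =
      (c * ((((q : ℝ) ^ (2 * k) : ℝ) : ℂ)) ^ 2) • x := by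
    have h1 : star ((y : SU q) * star (genb q) ^ 2) * ((y : SU q) * star (genb q) ^ 2) =
        c • ((chiPt q k : SU q) * (star (genb (q : ℝ)) * genb q) ^ 2) := by
      rw [star_mul, star_pow, star_star, mul_assoc, ← mul_assoc (star (y : SU q)), hycoe,
        smul_mul_assoc, mul_smul_comm, ← mul_assoc, ← hcomm.eq, mul_assoc, ← hn.mul_pow, hn.eq]
    rw [h1, sq, smul_mul_assoc, mul_assoc, mul_assoc, hAx, mul_smul_comm, hAx, mul_smul_comm,
      mul_smul_comm, hchix, smul_smul, smul_smul, mul_assoc, sq]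
  have hnorm : ‖leftMul q ((y : SU q) * star (genb q) ^ 2) (toHh q x)‖ ^ 2 =
      ‖c‖ * ((q : ℝ) ^ (2 * k)) ^ 2 * ‖toHh q x‖ ^ 2 := by
    have h1 : ((‖leftMul q ((y : SU q) * star (genb q) ^ 2) (toHh q x)‖ : ℝ) : ℂ) ^ 2 =
        c * ((((q : ℝ) ^ (2 * k) : ℝ) : ℂ)) ^ 2 * ((‖toHh q x‖ : ℝ) : ℂ) ^ 2 := by
      rw [leftMul_toHh, norm_toHh_sq, norm_toHh_sq, star_mul, mul_assoc (star x),
        ← mul_assoc (star ((y : SU q) * star (genb q) ^ 2)), hprod, mul_smul_comm, map_smul,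
        smul_eq_mul]
    have h2 := congrArg norm h1
    simpa only [norm_mul, norm_pow, Complex.norm_real, norm_norm, Real.norm_of_nonneg hp.le]
      using h2
  refine le_of_mul_le_mul_right ?_ hpos
  refine le_trans ?_ hle
  refine le_of_sq_le_sq ?_ (norm_nonneg _)
  rw [hnorm, mul_pow, mul_pow, mul_comm (((q : ℝ) ^ (2 * k)) ^ 2)]
  gcongr

lemma isFibrePart_fibrePart {q : Set.Ioo (0 : ℝ) 1} (ξ : X q) (k : ℕ) :
    IsFibrePart (ξ : Hplus q →L[ℂ] Hminus q) k (fibrePart ξ k) := (ξ.2 k).choose_spec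

/-- Here (b*)² b² = A² acts on Y_l from the right as q^{4l}; after division by q^{2l} the remaining
factor is the one in `norm_fibrePart_le`. -/
lemma integrand_eq_smul {q : Set.Ioo (0 : ℝ) 1} (ξ : X q) (l : ℕ) :
    integrand ξ l = (((q : ℝ) ^ (2 * l) : ℝ) : ℂ) • fibrePart ξ l := by
  have hp : (((q : ℝ) ^ (2 * l) : ℝ) : ℂ) ≠ 0 := by exact_mod_cast (pow_pos q.2.1 (2 * l)).ne'
  have hy := mul_chiPt_of_mem_fibre (isFibrePart_fibrePart ξ l).1
  have h1 : fibrePart ξ l * elA q = (((q : ℝ) ^ (2 * l) : ℝ) : ℂ) • fibrePart ξ l := by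
    nth_rewrite 1 [← hy]
    rw [mul_assoc, chiPt_mul_elA, mul_smul_comm, hy]
  have h2 : (⟨(fibrePart ξ l : SU q) * star (genb q) ^ 2 * genb q ^ 2,
      mul_bstar_sq_mul_b_sq_mem _⟩ : Sphere q) = fibrePart ξ l * elA q * elA q := by
    apply Subtype.ext
    change (fibrePart ξ l : SU q) * star (genb q) ^ 2 * genb q ^ 2 =
      (fibrePart ξ l : SU q) * (star (genb q) * genb q) * (star (genb q) * genb q)
    rw [mul_assoc, bstar_sq_mul_b_sq, sq, ← mul_assoc]
  rw [integrand, h2, h1, smul_mul_assoc, h1, Complex.ofReal_inv, inv_smul_smul₀ hp]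

lemma norm_integrand_le {q : Set.Ioo (0 : ℝ) 1} (ξ : X q) (l : ℕ) :
    ‖integrand ξ l‖ ≤ ‖(ξ : Hplus q →L[ℂ] Hminus q)‖ := by
  rw [integrand_eq_smul, norm_smul, Complex.norm_real,
    Real.norm_of_nonneg (pow_pos q.2.1 (2 * l)).le]
  exact norm_fibrePart_le (isFibrePart_fibrePart ξ l)

lemma integrand_mul_chiPt {q : Set.Ioo (0 : ℝ) 1} (ξ : X q) (l : ℕ) :
    integrand ξ l * chiPt q l = integrand ξ l := by
  rw [integrand_eq_smul, smul_mul_assoc, mul_chiPt_of_mem_fibre (isFibrePart_fibrePart ξ l).1]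

/-! ### Norm bounds for the operators on the fibres -/

/-- No summability is required: a divergent `tsum` has the default value 0. Uniform bounds on finite
sums therefore suffice for all the fibre operators. -/
lemma norm_tsum_le_of_norm_sum_le {E : Type*} [NormedAddCommGroup E] {f : ℕ → E} {M : ℝ}
    (h : ∀ s : Finset ℕ, ‖∑ n ∈ s, f n‖ ≤ M) : ‖∑' n, f n‖ ≤ M := by
  by_cases hf : Summable f
  · exact le_of_tendsto' hf.hasSum.norm h
  · rw [tsum_eq_zero_of_not_summable hf]
    simpa using h ∅

lemma tsum_mul_eq_self {R : Type*} [NonUnitalNonAssocSemiring R] [TopologicalSpace R]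
    [IsTopologicalSemiring R] [T2Space R] {f : ℕ → R} {c : R} (h : ∀ n, f n * c = f n) :
    (∑' n, f n) * c = ∑' n, f n := by
  by_cases hf : Summable f
  · rw [← hf.tsum_mul_right]
    simp only [h]
  · rw [tsum_eq_zero_of_not_summable hf, zero_mul]

lemma norm_mul_le_of_norm_le_one {R : Type*} [NonUnitalSeminormedRing R] {x y : R}
    (hx : ‖x‖ ≤ 1) : ‖x * y‖ ≤ ‖y‖ :=
  (norm_mul_le x y).trans (mul_le_of_le_one_left (norm_nonneg y) hx)

lemma norm_mul_le_of_norm_le_one_right {R : Type*} [NonUnitalSeminormedRing R] {x y : R}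
    (hy : ‖y‖ ≤ 1) : ‖x * y‖ ≤ ‖x‖ :=
  (norm_mul_le x y).trans (mul_le_of_le_one_right (norm_nonneg x) hy)

lemma norm_matUnit_succ_left_le (q : Set.Ioo (0 : ℝ) 1) (n : ℕ) : ‖matUnit q (n + 1) n‖ ≤ 1 := by
  simpa using norm_sum_matUnit_succ_left_le q {n}

lemma norm_matUnit_succ_right_le (q : Set.Ioo (0 : ℝ) 1) (n : ℕ) : ‖matUnit q n (n + 1)‖ ≤ 1 := by
  simpa using norm_sum_matUnit_succ_right_le q {n}

lemma norm_shiftV_le (q : Set.Ioo (0 : ℝ) 1) (y : Sphere q) : ‖shiftV q y‖ ≤ ‖y‖ := by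
  refine norm_tsum_le_of_norm_sum_le fun s => ?_
  rw [← Finset.sum_mul]
  exact norm_mul_le_of_norm_le_one (norm_sum_matUnit_succ_left_le q s)

lemma norm_shiftH_le (q : Set.Ioo (0 : ℝ) 1) (k : ℕ) (y : Sphere q) :
    ‖shiftH q k y‖ ≤ ‖y‖ := by
  refine norm_tsum_le_of_norm_sum_le fun s => ?_
  rw [← Finset.sum_mul, ← Finset.sum_mul]
  exact (norm_mul_le_of_norm_le_one_right (norm_matUnit_succ_right_le q k)).trans
    (norm_mul_le_of_norm_le_one (norm_sum_matUnit_succ_left_le q s))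

lemma norm_shiftHAdj_le (q : Set.Ioo (0 : ℝ) 1) (k : ℕ) (y : Sphere q) :
    ‖shiftHAdj q k y‖ ≤ ‖y‖ := by
  refine norm_tsum_le_of_norm_sum_le fun s => ?_
  rw [← Finset.sum_mul, ← Finset.sum_mul]
  exact (norm_mul_le_of_norm_le_one_right (norm_matUnit_succ_left_le q k)).trans
    (norm_mul_le_of_norm_le_one (norm_sum_matUnit_succ_right_le q s))

lemma norm_opP_le (q : Set.Ioo (0 : ℝ) 1) (k : ℕ) (y : Sphere q) : ‖opP q k y‖ ≤ ‖y‖ := by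
  rw [opP, ← Finset.sum_mul]
  simp only [matUnit_self]
  exact norm_mul_le_of_norm_le_one (norm_sum_chiPt_le q _)

lemma norm_tsum_ite_smul_le (q : Set.Ioo (0 : ℝ) 1) {p : ℕ → Prop} [DecidablePred p] {c : ℕ → ℝ}
    {M : ℝ} (hM : 0 ≤ M) (hc : ∀ n, p n → |c n| ≤ M) (y : Sphere q) :
    ‖∑' n : ℕ, if p n then (c n : ℂ) • (matUnit q n n * y) else 0‖ ≤ M * ‖y‖ := by
  refine norm_tsum_le_of_norm_sum_le fun s => ?_
  have h : ∀ n, (if p n then (c n : ℂ) • (matUnit q n n * y) else 0) =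
      (((if p n then c n else 0 : ℝ) : ℂ) • chiPt q n) * y := fun n => by
    rw [matUnit_self]
    split_ifs
    · rw [smul_mul_assoc]
    · rw [Complex.ofReal_zero, zero_smul, zero_mul]
  simp only [h]
  rw [← Finset.sum_mul]
  refine (norm_mul_le _ _).trans (mul_le_mul_of_nonneg_right ?_ (norm_nonneg y))
  refine norm_sum_smul_chiPt_le q s hM fun n => ?_
  split_ifs with hn
  · exact hc n hn
  · simpa using hM

lemma sqrt_div_le_one (q : Set.Ioo (0 : ℝ) 1) {m n : ℕ} (h : m ≤ n) :
    √((1 - (q : ℝ) ^ m) / (1 - (q : ℝ) ^ n)) ≤ 1 := by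
  refine Real.sqrt_le_one.mpr (div_le_one_of_le₀ ?_ (one_sub_pow_nonneg q n))
  have := pow_le_pow_of_le_one q.2.1.le q.2.2.le h
  linarith

/-- At n = k + 1 the coefficient equals 1, so no decay comes from Γ; this is why the m + 1 vertical
summands produce a factor m + 1. -/
lemma norm_opGamma_le (q : Set.Ioo (0 : ℝ) 1) (k : ℕ) (y : Sphere q) :
    ‖opGamma q k y‖ ≤ ‖y‖ := by
  rw [← one_mul ‖y‖]
  refine norm_tsum_ite_smul_le q (p := fun n => k + 1 ≤ n) zero_le_one (fun n hn => ?_) y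
  rw [abs_of_nonneg (mul_nonneg (pow_nonneg q.2.1.le _) (Real.sqrt_nonneg _))]
  exact mul_le_one₀ (pow_le_one₀ q.2.1.le q.2.2.le) (Real.sqrt_nonneg _)
    (sqrt_div_le_one q (by omega))

/-- The exponent k - n + 1 is at least 1 for n ≤ k. This factor q makes the inner horizontal series
geometric. -/
lemma norm_opDelta_le (q : Set.Ioo (0 : ℝ) 1) (k : ℕ) (y : Sphere q) :
    ‖opDelta q k y‖ ≤ (q : ℝ) * ‖y‖ := by
  refine norm_tsum_ite_smul_le q (p := fun n => 0 < n ∧ n ≤ k) q.2.1.le (fun n hn => ?_) y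
  rw [abs_of_nonneg (mul_nonneg (pow_nonneg q.2.1.le _) (Real.sqrt_nonneg _)), ← mul_one (q : ℝ)]
  refine mul_le_mul ?_ ?_ (Real.sqrt_nonneg _) q.2.1.le
  · rw [mul_one]
    exact pow_le_of_le_one q.2.1.le q.2.2.le (Nat.succ_ne_zero _)
  · rw [mul_one]
    exact sqrt_div_le_one q (by omega)

lemma norm_powUp_le (q : Set.Ioo (0 : ℝ) 1) (l j : ℕ) (y : Sphere q) :
    ‖powUp q l j y‖ ≤ ‖y‖ := by
  induction j with
  | zero => exact le_rfl
  | succ j ih => exact (norm_shiftH_le q _ _).trans ((norm_opGamma_le q _ _).trans ih)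

lemma norm_powDown_le (q : Set.Ioo (0 : ℝ) 1) (p j : ℕ) (y : Sphere q) :
    ‖powDown q p j y‖ ≤ (q : ℝ) ^ j * ‖y‖ := by
  -- `powDown` applies its first operators to the argument before recursing, so y changes.
  induction j generalizing y with
  | zero => simp [powDown]
  | succ j ih =>
    refine (ih _).trans ?_
    rw [pow_succ, mul_assoc]
    exact mul_le_mul_of_nonneg_left ((norm_shiftHAdj_le q _ _).trans (norm_opDelta_le q _ _))
      (pow_nonneg q.2.1.le j)

/-! ### Preservation of the fibres -/

lemma shiftV_mul_eq_self {q : Set.Ioo (0 : ℝ) 1} {y c : Sphere q} (h : y * c = y) :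
    shiftV q y * c = shiftV q y :=
  tsum_mul_eq_self fun n => by rw [mul_assoc, h]

lemma opGamma_mul_eq_self {q : Set.Ioo (0 : ℝ) 1} (k : ℕ) {y c : Sphere q} (h : y * c = y) :
    opGamma q k y * c = opGamma q k y :=
  tsum_mul_eq_self fun n => by
    split_ifs
    · rw [smul_mul_assoc, mul_assoc, h]
    · rw [zero_mul]

lemma shiftH_mul_chiPt (q : Set.Ioo (0 : ℝ) 1) (k : ℕ) (y : Sphere q) :
    shiftH q k y * chiPt q (k + 1) = shiftH q k y :=
  tsum_mul_eq_self fun n => by rw [mul_assoc, matUnit_mul_chiPt]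

lemma shiftHAdj_mul_chiPt (q : Set.Ioo (0 : ℝ) 1) (k : ℕ) (y : Sphere q) :
    shiftHAdj q k y * chiPt q k = shiftHAdj q k y :=
  tsum_mul_eq_self fun n => by rw [mul_assoc, matUnit_mul_chiPt]

lemma powUp_mul_chiPt {q : Set.Ioo (0 : ℝ) 1} {l : ℕ} (j : ℕ) {y : Sphere q}
    (h : y * chiPt q l = y) : powUp q l j y * chiPt q (l + j) = powUp q l j y := by
  rcases j with _ | j
  · exact h
  · exact shiftH_mul_chiPt q (l + j) _

/-- The term lies in Y_m: S^V and Γ multiply from the left only, and m - l horizontal shifts carry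
Y_l to Y_m. Together with `horTerm_mul_chiPt` this lets the spectral cut-off remove the low terms.
-/
lemma vertTerm_mul_chiPt {q : Set.Ioo (0 : ℝ) 1} (ξ : X q) (m : ℕ) :
    vertTerm ξ m * chiPt q m = vertTerm ξ m := by
  rw [vertTerm, smul_mul_assoc, Finset.sum_mul]
  congr 1
  refine Finset.sum_congr rfl fun l hl => opGamma_mul_eq_self m ?_
  have h := powUp_mul_chiPt (m - l) (shiftV_mul_eq_self (integrand_mul_chiPt ξ l))
  rwa [Nat.add_sub_cancel' (Nat.lt_succ_iff.mp (Finset.mem_range.mp hl))] at h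

lemma horTerm_mul_chiPt {q : Set.Ioo (0 : ℝ) 1} (ξ : X q) (m : ℕ) :
    horTerm ξ m * chiPt q m = horTerm ξ m := by
  rw [horTerm, smul_mul_assoc]
  congr 1
  exact tsum_mul_eq_self fun j => shiftHAdj_mul_chiPt q m _

/-! ### The series of the quantum integral -/

lemma weight_nonneg (q : Set.Ioo (0 : ℝ) 1) (m : ℕ) : 0 ≤ weight q m :=
  mul_nonneg (pow_nonneg q.2.1.le m) (div_nonneg (one_sub_pow_nonneg q 2) (Real.sqrt_nonneg _))

lemma weight_le (q : Set.Ioo (0 : ℝ) 1) (m : ℕ) : weight q m ≤ (q : ℝ) ^ m := by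
  refine mul_le_of_le_one_right (pow_nonneg q.2.1.le m)
    (div_le_one_of_le₀ (Real.le_sqrt_of_sq_le ?_) (Real.sqrt_nonneg _))
  -- The chain is (1 - q²)² ≤ 1 - q² ≤ 1 - q^{2(m+1)}.
  have h1 : (q : ℝ) ^ (2 * (m + 1)) ≤ (q : ℝ) ^ 2 :=
    pow_le_pow_of_le_one q.2.1.le q.2.2.le (by omega)
  nlinarith [one_sub_pow_nonneg q 2, sq_nonneg (q : ℝ)]

lemma norm_weight_smul_le (q : Set.Ioo (0 : ℝ) 1) (m : ℕ) (y : Sphere q) :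
    ‖(weight q m : ℂ) • y‖ ≤ (q : ℝ) ^ m * ‖y‖ := by
  rw [norm_smul, Complex.norm_real, Real.norm_of_nonneg (weight_nonneg q m)]
  exact mul_le_mul_of_nonneg_right (weight_le q m) (norm_nonneg y)

lemma norm_vertTerm_le {q : Set.Ioo (0 : ℝ) 1} (ξ : X q) (m : ℕ) : ‖vertTerm ξ m‖ ≤
    (q : ℝ) ^ m * (((m : ℝ) + 1) * ‖(ξ : Hplus q →L[ℂ] Hminus q)‖) := by
  refine (norm_weight_smul_le q m _).trans
    (mul_le_mul_of_nonneg_left ?_ (pow_nonneg q.2.1.le m))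
  refine (norm_sum_le_of_le _ fun l _ => (norm_opGamma_le q _ _).trans
    ((norm_powUp_le q _ _ _).trans ((norm_shiftV_le q _).trans (norm_integrand_le ξ l)))).trans ?_
  simp

lemma norm_horInner_le {q : Set.Ioo (0 : ℝ) 1} (ξ : X q) (m j : ℕ) : ‖horInner ξ m j‖ ≤
    (q : ℝ) ^ j * ‖(ξ : Hplus q →L[ℂ] Hminus q)‖ :=
  (norm_shiftHAdj_le q _ _).trans <| (norm_powDown_le q _ _ _).trans <|
    mul_le_mul_of_nonneg_left ((norm_opP_le q _ _).trans ((norm_shiftV_le q _).trans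
      (norm_integrand_le ξ _))) (pow_nonneg q.2.1.le j)

lemma hasSum_norm_horInner_bound {q : Set.Ioo (0 : ℝ) 1} (ξ : X q) :
    HasSum (fun j : ℕ => (q : ℝ) ^ j * ‖(ξ : Hplus q →L[ℂ] Hminus q)‖)
      ((1 - (q : ℝ))⁻¹ * ‖(ξ : Hplus q →L[ℂ] Hminus q)‖) :=
  (hasSum_geometric_of_lt_one q.2.1.le q.2.2).mul_right _

lemma summable_horInner {q : Set.Ioo (0 : ℝ) 1} (ξ : X q) (m : ℕ) :
    Summable fun j : ℕ => horInner ξ m j :=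
  .of_norm_bounded (hasSum_norm_horInner_bound ξ).summable (norm_horInner_le ξ m)

lemma norm_horTerm_le {q : Set.Ioo (0 : ℝ) 1} (ξ : X q) (m : ℕ) : ‖horTerm ξ m‖ ≤
    (q : ℝ) ^ m * ((1 - (q : ℝ))⁻¹ * ‖(ξ : Hplus q →L[ℂ] Hminus q)‖) :=
  (norm_weight_smul_le q m _).trans (mul_le_mul_of_nonneg_left
    (tsum_of_norm_bounded (hasSum_norm_horInner_bound ξ) (norm_horInner_le ξ m))
    (pow_nonneg q.2.1.le m))

lemma hasSum_mul_geometric_add {r : ℝ} (h0 : 0 ≤ r) (h1 : r < 1) (c : ℝ) :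
    HasSum (fun i : ℕ => r ^ i * ((i : ℝ) + c)) (r / (1 - r) ^ 2 + (1 - r)⁻¹ * c) := by
  have hr : ‖r‖ < 1 := by rwa [Real.norm_of_nonneg h0]
  refine ((hasSum_coe_mul_geometric_of_norm_lt_one hr).add
    ((hasSum_geometric_of_lt_one h0 h1).mul_right c)).congr_fun fun i => ?_
  ring

lemma summable_vertTerm {q : Set.Ioo (0 : ℝ) 1} (ξ : X q) : Summable fun m => vertTerm ξ m := by
  refine .of_norm_bounded ((hasSum_mul_geometric_add q.2.1.le q.2.2 1).summable.mul_right
    ‖(ξ : Hplus q →L[ℂ] Hminus q)‖) fun m => (norm_vertTerm_le ξ m).trans_eq ?_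
  ring

lemma summable_horTerm {q : Set.Ioo (0 : ℝ) 1} (ξ : X q) : Summable fun m => horTerm ξ m :=
  .of_norm_bounded ((summable_geometric_of_lt_one q.2.1.le q.2.2).mul_right _) (norm_horTerm_le ξ)

lemma norm_integral_mul_chiIcc_le {q : Set.Ioo (0 : ℝ) 1} (ξ : X q) (k : ℕ) :
    ‖integral ξ * chiIcc q k‖ ≤ ‖(ξ : Hplus q →L[ℂ] Hminus q)‖ * (q : ℝ) ^ k *
      ((k : ℝ) + 2) / (1 - (q : ℝ)) ^ 2 := by
  have hN := norm_nonneg (ξ : Hplus q →L[ℂ] Hminus q)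
  set N := ‖(ξ : Hplus q →L[ℂ] Hminus q)‖
  have hq1 : 0 < 1 - (q : ℝ) := sub_pos.mpr q.2.2
  have hs : Summable fun m => horTerm ξ m - vertTerm ξ m :=
    (summable_horTerm ξ).sub (summable_vertTerm ξ)
  have hlow : ∀ m < k, (horTerm ξ m - vertTerm ξ m) * chiIcc q k = 0 := fun m hm => by
    rw [← horTerm_mul_chiPt, ← vertTerm_mul_chiPt, ← sub_mul, mul_assoc,
      chiPt_mul_chiIcc_of_lt q hm, mul_zero]
  have hint : integral ξ * chiIcc q k =
      ∑' i : ℕ, (horTerm ξ (i + k) - vertTerm ξ (i + k)) * chiIcc q k := by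
    have h1 : integral ξ = ∑' m, (horTerm ξ m - vertTerm ξ m) := by
      rw [(summable_horTerm ξ).tsum_sub (summable_vertTerm ξ), integral, integralV, integralH,
        neg_add_eq_sub]
    rw [h1, ← hs.tsum_mul_right, ← (hs.mul_right (chiIcc q k)).sum_add_tsum_nat_add k,
      Finset.sum_eq_zero fun m hm => hlow m (Finset.mem_range.mp hm), zero_add]
  -- With m = i + k, the vertical part contributes i + k + 1 and the horizontal part (1 - q)⁻¹.
  have hbound : ∀ i : ℕ, ‖(horTerm ξ (i + k) - vertTerm ξ (i + k)) * chiIcc q k‖ ≤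
      N * (q : ℝ) ^ k * ((q : ℝ) ^ i * ((i : ℝ) + ((k : ℝ) + 1 + (1 - (q : ℝ))⁻¹))) := fun i => by
    refine (norm_mul_le_of_norm_le_one_right (norm_chiIcc_le q k)).trans ((norm_sub_le _ _).trans
      ((add_le_add (norm_horTerm_le ξ _) (norm_vertTerm_le ξ _)).trans_eq ?_))
    push_cast
    ring
  rw [hint]
  refine (tsum_of_norm_bounded ((hasSum_mul_geometric_add q.2.1.le q.2.2 _).mul_left _)
    hbound).trans ?_
  rw [mul_div_assoc]
  refine mul_le_mul_of_nonneg_left ?_ (mul_nonneg hN (pow_nonneg q.2.1.le k))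
  rw [le_div_iff₀ (pow_pos hq1 2)]
  -- The exact tail constant is k + 2 - kq; dropping -kq gives the stated bound.
  have h2 : ((q : ℝ) / (1 - (q : ℝ)) ^ 2 + (1 - (q : ℝ))⁻¹ * ((k : ℝ) + 1 + (1 - (q : ℝ))⁻¹)) *
      (1 - (q : ℝ)) ^ 2 = (k : ℝ) + 2 - k * q := by
    have := hq1.ne'
    field_simp
    ring
  rw [h2]
  linarith [mul_nonneg (Nat.cast_nonneg (α := ℝ) k) q.2.1.le]

end

end Podles

theorem propositionp (q : Set.Ioo (0 : ℝ) 1) (ξ : Podles.X q) :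
    (Summable fun m : ℕ => Podles.vertTerm ξ m) ∧
    (∀ m : ℕ, Summable fun j : ℕ => Podles.horInner ξ m j) ∧
    (Summable fun m : ℕ => Podles.horTerm ξ m) ∧
    ∀ k : ℕ, ‖Podles.integral ξ * Podles.chiIcc q k‖ ≤
      ‖(ξ : Podles.Hplus q →L[ℂ] Podles.Hminus q)‖ * (q : ℝ) ^ k * ((k : ℝ) + 2) / (1 - (q : ℝ)) ^ 2 :=
  ⟨Podles.summable_vertTerm ξ, Podles.summable_horInner ξ, Podles.summable_horTerm ξ,
    Podles.norm_integral_mul_chiIcc_le ξ⟩
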